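/- Let $L>0$, $\kappa_1>0$, $\kappa_2\in\mathbb R$, and let $$\Phi(s)=\begin{cases}\kappa_2^2s^2/2,&|s|\le 1,\\ \kappa_2^2/2,&|s|>1,\end{cases}$$ with (Clarke) subdifferential $\partial\Phi(s)=\{\kappa_2^2 s\}$ if $|s|<1$, $\{0\}$ if $|s|>1$, $[0,\kappa_2^2]$ if $s=1$ and $[-\kappa_2^2,0]$ if $s=-1$. Given $v_0\in H^2(0,L)$ and $v_1\in L^2(0,L)$, consider the problem $$u_{tt}=-\kappa_1^2u_{xxxx}-\Phi'(u)\ \text{ for } t>0,\ 0<x<L,\qquad u_x=u_{xxx}=0\ \text{ at } x=0,L,\qquad u(0,\cdot)=v_0,\quad u_t(0,\cdot)=v_1. \tag{1}$$ A function $u:[0,\infty)\times[0,L]\to\mathbb R$ is a *dissipative solution* of (1) if (i) $u$ is continuous on $[0,\infty)\times[0,L]$; (ii) the weak derivatives satisfy $\partial_tu,\ \partial_{xx}^2u\in L^\infty(0,\infty;L^2(0,L))$, and $u\in L^\infty(0,T;H^2(0,L))$ for every $T>0$; (iii) $\partial_xu(t,0)=\partial_xu(t,L)=0$ for a.e. $t>0$;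 (iv) there is a measurable function $h$ with $h(t,x)\in\partial\Phi(u(t,x))$ for a.e. $(t,x)\in(0,\infty)\times(0,L)$ such that, for every $\varphi\in C_c^\infty(\mathbb R^2)$ with $\partial_x\varphi(\cdot,0)=\partial_x\varphi(\cdot,L)=0$, $$\int_0^\infty\!\!\int_0^L\big(u\,\partial_{tt}^2\varphi+\kappa_1^2\,\partial_{xx}^2u\,\partial_{xx}^2\varphi+h\varphi\big)\,dx\,dt-\int_0^Lv_1(x)\varphi(0,x)\,dx+\int_0^Lv_0(x)\,\partial_t\varphi(0,x)\,dx=0;$$ (v) $E[u](t)\le E[u](0)$ for a.e. $t>0$, where $$E[u](t)=\int_0^L\Big(\frac{(\partial_tu(t,x))^2+\kappa_1^2(\partial_{xx}^2u(t,x))^2}{2}+\Phi(u(t,x))\Big)dx,\qquad E[u](0)=\int_0^L\Big(\frac{v_1^2+\kappa_1^2(v_0'')^2}{2}+\Phi(v_0)\Big)dx.$$ **Theorem.** Let $u$ be a dissipative solution of (1). Assume that $v_0$ and $v_1$ are (a.e. equal to) constants with $|v_0|<1$; that $\bar t>0$ is a time such that $|u(\bar t,x)|>1$ for every $x\in[0,L]$;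 that $u\in C^1([0,\infty)\times[0,L])$; and that the energy is preserved, i.e. $E[u](t)=E[u](0)$ for a.e. $t>0$. Then for every $t\ge\bar t$ the function $x\mapsto u(t,x)$ is constant on $[0,L]$. -/

import Mathlib

open MeasureTheory Set Filter Topology
open scoped ContDiff NNReal

noncomputable section

namespace Beam

/-! Space-time points are pairs `(t, x) : ℝ × ℝ`, time first. -/

/-- `g` is the weak (distributional) derivative of `f` in the direction `e` on the open set `Ω`:
both are locally integrable on `Ω` and `∫_Ω f ∂ₑφ = -∫_Ω g φ` for all `φ ∈ C_c^∞(Ω)`. -/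
def HasWeakDerivAlong {E : Type*} [NormedAddCommGroup E] [NormedSpace ℝ E] [MeasureSpace E]
    (Ω : Set E) (e : E) (f g : E → ℝ) : Prop :=
  LocallyIntegrableOn f Ω ∧ LocallyIntegrableOn g Ω ∧
    ∀ φ : E → ℝ, ContDiff ℝ ∞ φ → HasCompactSupport φ → tsupport φ ⊆ Ω →
      ∫ z in Ω, f z * fderiv ℝ φ z e = -∫ z in Ω, g z * φ z

open Classical in
/-- The weak derivative of `f` in the direction `e` on `Ω` (determined up to a null set of `Ω`
whenever it exists; the zero function, by convention, if it does not exist). -/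
def weakDerivAlong {E : Type*} [NormedAddCommGroup E] [NormedSpace ℝ E] [MeasureSpace E]
    (Ω : Set E) (e : E) (f : E → ℝ) : E → ℝ :=
  if h : ∃ g, HasWeakDerivAlong Ω e f g then h.choose else 0

/-- `f` has a weak derivative in the direction `e` on `Ω`. -/
def WeaklyDifferentiableAlong {E : Type*} [NormedAddCommGroup E] [NormedSpace ℝ E]
    [MeasureSpace E] (Ω : Set E) (e : E) (f : E → ℝ) : Prop :=
  ∃ g, HasWeakDerivAlong Ω e f g

/-- The space-time domain `(0, ∞) × (0, L)`. -/
def strip (L : ℝ) : Set (ℝ × ℝ) := Ioi 0 ×ˢ Ioo 0 L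

/-- Its closure `[0, ∞) × [0, L]`. -/
def closedStrip (L : ℝ) : Set (ℝ × ℝ) := Ici 0 ×ˢ Icc 0 L

/-- The weak derivative `∂ₜ u` on `(0, ∞) × (0, L)`. -/
def weakDt (L : ℝ) (u : ℝ × ℝ → ℝ) : ℝ × ℝ → ℝ := weakDerivAlong (strip L) (1, 0) u

/-- The weak derivative `∂ₓ u` on `(0, ∞) × (0, L)`. -/
def weakDx (L : ℝ) (u : ℝ × ℝ → ℝ) : ℝ × ℝ → ℝ := weakDerivAlong (strip L) (0, 1) u

/-- The weak derivative `∂ₓₓ u` on `(0, ∞) × (0, L)`. -/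
def weakDxx (L : ℝ) (u : ℝ × ℝ → ℝ) : ℝ × ℝ → ℝ := weakDx L (weakDx L u)

/-- The weak derivative of a function of `x` on `(0, L)`. -/
def weakDeriv (L : ℝ) (v : ℝ → ℝ) : ℝ → ℝ := weakDerivAlong (Ioo 0 L) (1 : ℝ) v

/-- `v ∈ L²(0, L)`. -/
def MemL2 (L : ℝ) (v : ℝ → ℝ) : Prop := MemLp v 2 (volume.restrict (Ioo 0 L))

/-- `v ∈ H²(0, L)`. -/
def MemH2 (L : ℝ) (v : ℝ → ℝ) : Prop :=
  MemL2 L v ∧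
  WeaklyDifferentiableAlong (Ioo 0 L) (1 : ℝ) v ∧ MemL2 L (weakDeriv L v) ∧
  WeaklyDifferentiableAlong (Ioo 0 L) (1 : ℝ) (weakDeriv L v) ∧
    MemL2 L (weakDeriv L (weakDeriv L v))

/-- `g ∈ L^∞(I; L²(0, L))` for a set `I` of times. -/
def MemLinftyL2 (I : Set ℝ) (L : ℝ) (g : ℝ × ℝ → ℝ) : Prop :=
  AEStronglyMeasurable g (volume.restrict (I ×ˢ Ioo 0 L)) ∧
    ∃ C : ℝ≥0, ∀ᵐ t ∂(volume.restrict I),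
      eLpNorm (fun x => g (t, x)) 2 (volume.restrict (Ioo 0 L)) ≤ C

/-- The adhesive potential `Φ`. -/
def potential (κ₂ s : ℝ) : ℝ := if |s| ≤ 1 then κ₂ ^ 2 * s ^ 2 / 2 else κ₂ ^ 2 / 2

/-- The (Clarke) subdifferential of a locally Lipschitz function `f : ℝ → ℝ` at `s`: the convex
hull of all limits of `f'(yₙ)` along sequences `yₙ → s` of points of differentiability.  For
`f = Φ` it is `{Φ'(s)}` if `|s| ≠ 1`, `[0, κ₂²]` if `s = 1` and `[-κ₂², 0]` if `s = -1`. -/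
def subdifferential (f : ℝ → ℝ) (s : ℝ) : Set ℝ :=
  convexHull ℝ {ξ : ℝ | ∃ y : ℕ → ℝ, Tendsto y atTop (𝓝 s) ∧
    (∀ n, DifferentiableAt ℝ f (y n)) ∧ Tendsto (fun n => deriv f (y n)) atTop (𝓝 ξ)}

/-- `∫₀ᴸ ((p² + κ₁² q²) / 2 + Φ(w)) dx`, the energy of a state with displacement `w`,
velocity `p` and second space derivative `q`. -/
def stateEnergy (κ₁ κ₂ L : ℝ) (w p q : ℝ → ℝ) : ℝ :=
  ∫ x in Ioo 0 L, (((p x) ^ 2 + κ₁ ^ 2 * (q x) ^ 2) / 2 + potential κ₂ (w x))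

/-- The energy `E[u](t)`; for a dissipative solution it is determined for almost every `t`. -/
def energy (κ₁ κ₂ L : ℝ) (u : ℝ × ℝ → ℝ) (t : ℝ) : ℝ :=
  stateEnergy κ₁ κ₂ L (fun x => u (t, x)) (fun x => weakDt L u (t, x))
    (fun x => weakDxx L u (t, x))

/-- The initial energy `E[u](0)`, expressed through the initial data `v₀`, `v₁`. -/
def initialEnergy (κ₁ κ₂ L : ℝ) (v₀ v₁ : ℝ → ℝ) : ℝ :=
  stateEnergy κ₁ κ₂ L v₀ v₁ (weakDeriv L (weakDeriv L v₀))

/-- Classical `∂ₜ φ`, for smooth test functions. -/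
def partialT (φ : ℝ × ℝ → ℝ) (z : ℝ × ℝ) : ℝ := fderiv ℝ φ z (1, 0)

/-- Classical `∂ₓ φ`, for smooth test functions. -/
def partialX (φ : ℝ × ℝ → ℝ) (z : ℝ × ℝ) : ℝ := fderiv ℝ φ z (0, 1)

/-- Weak formulation, with initial data `v₀`, `v₁`, of `u_tt = -κ₁² u_xxxx - h` on
`(0, ∞) × (0, L)` with `u_x = u_xxx = 0` at `x = 0, L`. -/
def IsWeakSolution (κ₁ L : ℝ) (v₀ v₁ : ℝ → ℝ) (u h : ℝ × ℝ → ℝ) : Prop :=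
  ∀ φ : ℝ × ℝ → ℝ, ContDiff ℝ ∞ φ → HasCompactSupport φ →
    (∀ t, partialX φ (t, 0) = 0) → (∀ t, partialX φ (t, L) = 0) →
    (∫ z in strip L, (u z * partialT (partialT φ) z
        + κ₁ ^ 2 * weakDxx L u z * partialX (partialX φ) z + h z * φ z))
      - (∫ x in Ioo 0 L, v₁ x * φ (0, x)) + (∫ x in Ioo 0 L, v₀ x * partialT φ (0, x)) = 0

/-- `u` is a dissipative solution on `[0, ∞) × [0, L]` of
`u_tt = -κ₁² u_xxxx - Φ'(u)`, `u_x = u_xxx = 0` at `x = 0, L`, `u(0, ·) = v₀`, `u_t(0, ·) = v₁`. -/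
structure IsDissipativeSolution (κ₁ κ₂ L : ℝ) (v₀ v₁ : ℝ → ℝ) (u : ℝ × ℝ → ℝ) : Prop where
  memH2_data : MemH2 L v₀
  memL2_data : MemL2 L v₁
  continuousOn : ContinuousOn u (closedStrip L)
  exists_dt : WeaklyDifferentiableAlong (strip L) (1, 0) u
  exists_dx : WeaklyDifferentiableAlong (strip L) (0, 1) u
  exists_dxx : WeaklyDifferentiableAlong (strip L) (0, 1) (weakDx L u)
  dt_mem : MemLinftyL2 (Ioi 0) L (weakDt L u)
  dxx_mem : MemLinftyL2 (Ioi 0) L (weakDxx L u)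
  /-- `u ∈ L^∞(0, T; H²(0, L))` for every `T > 0`. -/
  mem_H2 : ∀ T : ℝ, 0 < T → MemLinftyL2 (Ioo 0 T) L u ∧ MemLinftyL2 (Ioo 0 T) L (weakDx L u) ∧
    MemLinftyL2 (Ioo 0 T) L (weakDxx L u)
  /-- `∂ₓ u(t, 0) = ∂ₓ u(t, L) = 0` for a.e. `t > 0` (one-sided derivatives; `u(t, ·)` belongs to
  `H²(0, L)`, hence to `C¹([0, L])`, for a.e. `t`). -/
  boundary : ∀ᵐ t ∂(volume.restrict (Ioi (0 : ℝ))),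
    HasDerivWithinAt (fun x => u (t, x)) 0 (Icc 0 L) 0 ∧
    HasDerivWithinAt (fun x => u (t, x)) 0 (Icc 0 L) L
  weak : ∃ h : ℝ × ℝ → ℝ, AEStronglyMeasurable h (volume.restrict (strip L)) ∧
    (∀ᵐ z ∂(volume.restrict (strip L)), h z ∈ subdifferential (potential κ₂) (u z)) ∧
    IsWeakSolution κ₁ L v₀ v₁ u h
  dissipation : ∀ᵐ t ∂(volume.restrict (Ioi (0 : ℝ))),
    energy κ₁ κ₂ L u t ≤ initialEnergy κ₁ κ₂ L v₀ v₁

end Beam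

end

/-! Everything is decided by the spatial mean `y` of `u`, the mean velocity `p = y'`, and the energy
bound. Testing the equation with a function of `x` that is constant near `[0, L]` removes the
bending term, so `L * y''` is minus the spatial integral of the adhesive force `h`.

While `|u| < 1` everywhere, `h = κ₂² u`. Hence `y'' = -κ₂² y`, and `p² + κ₂² y²` keeps its initial
value `c₁² + κ₂² c₀²`. For constant data this value times `L / 2` is the whole initial energy. The
energy bound therefore says that the mean squares of `u_t` and `κ₂ u` add up to at most the squares
of their means, and equality in Jensen's inequality forces `u_t = p` throughout. So `u` stays equal
to `y`, and all points reach the threshold `σ = ±1` at the same time `τ`.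

At `τ` the velocity satisfies `p² = c₁² + κ₂² c₀² - κ₂²`. This is positive: otherwise the energy
bound would make `u_t` vanish whenever the whole beam is detached, and no point could move from the
threshold to `|u| > 1`. The beam thus leaves with nonzero outward velocity, and `C¹` regularity
gives a short interval of complete detachment, uniformly in `x`. There `h = 0`, `p` is constant, and
Jensen again gives `u_t = p τ`. The resulting formula `u = σ + p τ * (t - τ)` moves away from the
threshold, so detachment persists and the formula holds for all later times.

The proof has two layers: `IsDissipativeSolution.exists_isReducedSolution` extracts the facts about
means and energy, and `IsReducedSolution.eq_const_of_detached` is the argument above. -/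

namespace Beam

/-! ### Weak derivatives: uniqueness and agreement with classical derivatives. -/

section WeakDerivative

variable {E : Type*} [NormedAddCommGroup E] [MeasureSpace E]

theorem integrableOn_mul_of_tsupport_subset [BorelSpace E] {Ω : Set E} {g φ : E → ℝ}
    (hg : LocallyIntegrableOn g Ω) (hφ : Continuous φ) (hc : HasCompactSupport φ)
    (hs : tsupport φ ⊆ Ω) : Integrable (fun z => g z * φ z) := by
  have h1 : IntegrableOn g (tsupport φ) := hg.integrableOn_compact_subset hs hc
  have h2 : IntegrableOn (fun z => g z * φ z) (tsupport φ) :=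
    h1.mul_continuousOn hφ.continuousOn hc
  refine (integrableOn_iff_integrable_of_support_subset ?_).1 h2
  intro z hz
  exact subset_tsupport _ (right_ne_zero_of_mul hz)

/-- `weakDerivAlong` is an arbitrary choice among weak derivatives; this uniqueness allows it to be
computed in concrete cases. -/
theorem HasWeakDerivAlong.ae_eq [NormedSpace ℝ E] [BorelSpace E] [FiniteDimensional ℝ E]
    {Ω : Set E} (hΩ : IsOpen Ω) {e : E}
    {f f' g g' : E → ℝ}
    (h : HasWeakDerivAlong Ω e f g) (h' : HasWeakDerivAlong Ω e f' g')
    (hff' : f =ᵐ[volume.restrict Ω] f') : g =ᵐ[volume.restrict Ω] g' := by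
  have key : ∀ᵐ z, z ∈ Ω → (g - g') z = 0 := by
    refine hΩ.ae_eq_zero_of_integral_contDiff_smul_eq_zero (h.2.1.sub h'.2.1) ?_
    intro φ hφ hc hs
    have e1 := h.2.2 φ hφ hc hs
    have e2 := h'.2.2 φ hφ hc hs
    have e3 : ∫ z in Ω, f z * fderiv ℝ φ z e = ∫ z in Ω, f' z * fderiv ℝ φ z e := by
      refine integral_congr_ae ?_
      filter_upwards [hff'] with z hz
      rw [hz]
    have e4 : ∫ z in Ω, g z * φ z = ∫ z in Ω, g' z * φ z := by linarith
    have i1 := (integrableOn_mul_of_tsupport_subset h.2.1 hφ.continuous hc hs)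
    have i2 := (integrableOn_mul_of_tsupport_subset h'.2.1 hφ.continuous hc hs)
    have s : ∀ k : E → ℝ, ∫ z in Ω, k z * φ z = ∫ z, k z * φ z := by
      intro k
      refine setIntegral_eq_integral_of_forall_compl_eq_zero ?_
      intro z hz
      rw [image_eq_zero_of_notMem_tsupport (fun h => hz (hs h)), mul_zero]
    rw [s, s] at e4
    calc ∫ z, φ z • (g - g') z = ∫ z, (g z * φ z - g' z * φ z) := by
          congr 1; ext z; simp; ring
      _ = 0 := by rw [integral_sub i1 i2, e4, sub_self]
  rw [EventuallyEq, ae_restrict_iff' hΩ.measurableSet]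
  filter_upwards [key] with z hz hzΩ
  exact sub_eq_zero.1 (hz hzΩ)

theorem hasWeakDerivAlong_fderiv [NormedSpace ℝ E] [BorelSpace E] [FiniteDimensional ℝ E]
    [(volume : Measure E).IsAddHaarMeasure]
    {Ω : Set E} (hΩ : IsOpen Ω) (e : E) {f : E → ℝ} (hf : ContDiffOn ℝ 1 f Ω) :
    HasWeakDerivAlong Ω e f (fun z => fderiv ℝ f z e) := by
  have l1 : LocallyIntegrableOn f Ω := hf.continuousOn.locallyIntegrableOn hΩ.measurableSet
  have l2 : LocallyIntegrableOn (fun z => fderiv ℝ f z e) Ω :=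
    ((hf.continuousOn_fderiv_of_isOpen hΩ le_rfl).clm_apply continuousOn_const).locallyIntegrableOn
      hΩ.measurableSet
  refine ⟨l1, l2, fun φ hφ hc hs => ?_⟩
  have hφd : Continuous fun z => fderiv ℝ φ z e :=
    (hφ.continuous_fderiv (by simp)).clm_apply continuous_const
  have hcd : HasCompactSupport fun z => fderiv ℝ φ z e := hc.fderiv_apply ℝ e
  have hsd : tsupport (fun z => fderiv ℝ φ z e) ⊆ Ω :=
    (tsupport_fderiv_apply_subset ℝ e).trans hs
  rw [setIntegral_eq_integral_of_forall_compl_eq_zero (s := Ω),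
    setIntegral_eq_integral_of_forall_compl_eq_zero (s := Ω)]
  · refine integral_mul_fderiv_eq_neg_fderiv_mul_of_integrable
      (integrableOn_mul_of_tsupport_subset l2 hφ.continuous hc hs)
      (integrableOn_mul_of_tsupport_subset l1 hφd hcd hsd)
      (integrableOn_mul_of_tsupport_subset l1 hφ.continuous hc hs) ?_ ?_
    · intro z hz
      exact (hf.differentiableOn one_ne_zero).differentiableAt (hΩ.mem_nhds (hs hz))
    · intro z _
      exact hφ.differentiable (by simp) z
  · intro z hz
    rw [image_eq_zero_of_notMem_tsupport (fun h => hz (hs h)), mul_zero]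
  · intro z hz
    rw [image_eq_zero_of_notMem_tsupport (f := fun z => fderiv ℝ φ z e) (fun h => hz (hsd h)),
      mul_zero]

theorem WeaklyDifferentiableAlong.hasWeakDerivAlong [NormedSpace ℝ E]
    {Ω : Set E} {e : E} {f : E → ℝ}
    (h : WeaklyDifferentiableAlong Ω e f) : HasWeakDerivAlong Ω e f (weakDerivAlong Ω e f) := by
  have h' : ∃ g, HasWeakDerivAlong Ω e f g := h
  rw [weakDerivAlong, dif_pos h']
  exact h'.choose_spec

theorem weakDerivAlong_ae_eq_zero_of_const [NormedSpace ℝ E] [BorelSpace E]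
    [FiniteDimensional ℝ E]
    [(volume : Measure E).IsAddHaarMeasure] {Ω : Set E} (hΩ : IsOpen Ω) {e : E} {f : E → ℝ} {c : ℝ}
    (h : WeaklyDifferentiableAlong Ω e f) (hf : ∀ᵐ z ∂(volume.restrict Ω), f z = c) :
    ∀ᵐ z ∂(volume.restrict Ω), weakDerivAlong Ω e f z = 0 := by
  have hc := hasWeakDerivAlong_fderiv hΩ e (f := fun _ : E => c) contDiffOn_const
  simpa [EventuallyEq] using h.hasWeakDerivAlong.ae_eq hΩ hc hf

end WeakDerivative

/-! ### The classical time derivative up to the boundary. -/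

theorem isOpen_strip (L : ℝ) : IsOpen (strip L) := isOpen_Ioi.prod isOpen_Ioo

theorem strip_subset_closedStrip (L : ℝ) : strip L ⊆ closedStrip L :=
  prod_mono Ioi_subset_Ici_self Ioo_subset_Icc_self

theorem uniqueDiffOn_closedStrip {L : ℝ} (hL : 0 < L) : UniqueDiffOn ℝ (closedStrip L) :=
  (uniqueDiffOn_Ici 0).prod (uniqueDiffOn_Icc hL)

/-- The time derivative on `[0, ∞) × [0, L]` of a function that is `C¹` up to the boundary. -/
noncomputable def timeDeriv (L : ℝ) (u : ℝ × ℝ → ℝ) (z : ℝ × ℝ) : ℝ :=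
  fderivWithin ℝ u (closedStrip L) z (1, 0)

theorem continuousOn_timeDeriv {L : ℝ} (hL : 0 < L) {u : ℝ × ℝ → ℝ}
    (hu : ContDiffOn ℝ 1 u (closedStrip L)) : ContinuousOn (timeDeriv L u) (closedStrip L) :=
  (hu.continuousOn_fderivWithin (uniqueDiffOn_closedStrip hL) le_rfl).clm_apply continuousOn_const

theorem hasDerivWithinAt_timeDeriv {L : ℝ} {u : ℝ × ℝ → ℝ}
    (hu : ContDiffOn ℝ 1 u (closedStrip L)) {t x : ℝ} (ht : 0 ≤ t) (hx : x ∈ Icc 0 L) :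
    HasDerivWithinAt (fun s => u (s, x)) (timeDeriv L u (t, x)) (Ici 0) t := by
  have h1 : HasFDerivWithinAt u (fderivWithin ℝ u (closedStrip L) (t, x)) (closedStrip L) (t, x) :=
    ((hu.differentiableOn one_ne_zero) (t, x) ⟨ht, hx⟩).hasFDerivWithinAt
  have h2 : HasDerivWithinAt (fun s : ℝ => (s, x)) ((1, 0) : ℝ × ℝ) (Ici 0) t :=
    ((hasDerivAt_id t).prodMk (hasDerivAt_const t x)).hasDerivWithinAt
  exact h1.comp_hasDerivWithinAt t h2 (fun s hs => mk_mem_prod hs hx)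

theorem weakDt_ae_eq_timeDeriv {L : ℝ} {u : ℝ × ℝ → ℝ}
    (hu : ContDiffOn ℝ 1 u (closedStrip L)) (hd : WeaklyDifferentiableAlong (strip L) (1, 0) u) :
    weakDt L u =ᵐ[volume.restrict (strip L)] timeDeriv L u := by
  have hO := isOpen_strip L
  have h := hd.hasWeakDerivAlong.ae_eq hO
    (hasWeakDerivAlong_fderiv hO (1, 0) (hu.mono (strip_subset_closedStrip L))) (ae_eq_refl _)
  refine h.trans ?_
  rw [EventuallyEq, ae_restrict_iff' hO.measurableSet]
  refine Eventually.of_forall fun z hz => ?_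
  rw [timeDeriv, fderivWithin_of_mem_nhds
    (mem_of_superset (hO.mem_nhds hz) (strip_subset_closedStrip L))]

/-! ### Weak second-order equations on the half-line with initial data. -/

/-- A test function on the line has, on the positive half-line, an antiderivative which is again a
test function. -/
theorem exists_antideriv_test {g : ℝ → ℝ} (hg : ContDiff ℝ ∞ g) (hc : HasCompactSupport g) :
    ∃ θ : ℝ → ℝ, ContDiff ℝ ∞ θ ∧ HasCompactSupport θ ∧ ∀ t, 0 < t → deriv θ t = g t := by
  obtain ⟨R, hR⟩ := hc.isCompact.isBounded.subset_closedBall 0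
  have hF : ∀ t, HasDerivAt (fun t => ∫ s in R..t, g s) (g t) t := fun t =>
    intervalIntegral.integral_hasDerivAt_right (hg.continuous.intervalIntegrable _ _)
      (hg.continuous.stronglyMeasurableAtFilter _ _) hg.continuous.continuousAt
  have hFs : ContDiff ℝ ∞ (fun t => ∫ s in R..t, g s) := by
    rw [contDiff_infty_iff_deriv]
    refine ⟨fun t => (hF t).differentiableAt, ?_⟩
    rwa [show deriv (fun t => ∫ s in R..t, g s) = g from funext fun t => (hF t).deriv]
  have hF0 : ∀ t, R ≤ t → ∫ s in R..t, g s = 0 := by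
    intro t ht
    rw [intervalIntegral.integral_of_le ht]
    refine setIntegral_eq_zero_of_forall_eq_zero fun s hs => ?_
    refine image_eq_zero_of_notMem_tsupport fun h => ?_
    have := hR h
    rw [Metric.mem_closedBall, Real.dist_eq, sub_zero] at this
    exact absurd (le_abs_self s) (not_le.2 (this.trans_lt hs.1))
  -- The primitive based at `R` vanishes to the right of the support of `g`. Its possibly nonzero
  -- values on the left are cut off between `-1` and `0`, so `g` need not have zero mean.
  refine ⟨fun t => Real.smoothTransition (t + 1) * ∫ s in R..t, g s,
    (Real.smoothTransition.contDiff.comp (contDiff_id.add contDiff_const)).mul hFs, ?_, ?_⟩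
  · refine HasCompactSupport.intro (K := Icc (-1) R) isCompact_Icc fun t ht => ?_
    rcases le_or_gt (-1) t with h | h
    · rw [hF0 t (not_le.1 fun h' => ht ⟨h, h'⟩).le, mul_zero]
    · rw [Real.smoothTransition.zero_of_nonpos (by linarith), zero_mul]
  · intro t ht
    have : (fun t => Real.smoothTransition (t + 1) * ∫ s in R..t, g s) =ᶠ[𝓝 t]
        fun t => ∫ s in R..t, g s := by
      filter_upwards [lt_mem_nhds ht] with s hs
      rw [Real.smoothTransition.one_of_one_le (by linarith), one_mul]
    rw [this.deriv_eq, (hF t).deriv]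

/-- Integration by parts for absolutely continuous functions, as `b` is merely integrable. The
boundary terms vanish because the primitive is zero at `0` and `θ` is zero at `R`. -/
theorem integral_primitive_mul_deriv {b θ : ℝ → ℝ} {R : ℝ}
    (hb : IntervalIntegrable b volume 0 R) (hθ : ContDiff ℝ 1 θ) (hθR : θ R = 0) :
    ∫ t in (0 : ℝ)..R, (∫ s in (0 : ℝ)..t, b s) * deriv θ t = -∫ t in (0 : ℝ)..R, b t * θ t := by
  have h1 := hb.absolutelyContinuousOnInterval_intervalIntegral (c := 0) left_mem_uIcc
  have h2 : AbsolutelyContinuousOnInterval θ 0 R := hθ.contDiffOn.absolutelyContinuousOnInterval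
  rw [h1.integral_mul_deriv_eq_deriv_mul h2]
  simp only [hθR, intervalIntegral.integral_same, mul_zero, zero_mul, sub_zero, zero_sub, neg_inj]
  refine intervalIntegral.integral_congr_ae ?_
  filter_upwards [hb.ae_hasDerivAt_integral] with t ht htm
  rw [(ht (uIoc_subset_uIcc htm) 0 left_mem_uIcc).deriv]

/-- A du Bois-Reymond argument. Two integrations by parts show that the difference of the two sides
is orthogonal to every `θ''`; the boundary terms at `0` cancel those carrying `V₀` and `V₁`. Every
test function supported in `t > 0` agrees there with some `θ''`, so the difference vanishes. -/
theorem eq_of_weak_second_deriv {a b : ℝ → ℝ} {V₀ V₁ : ℝ} (ha : ContinuousOn a (Ici 0))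
    (hb : ∀ s t, IntervalIntegrable b volume s t)
    (h : ∀ θ : ℝ → ℝ, ContDiff ℝ ∞ θ → HasCompactSupport θ →
      ∫ t in Ioi 0, (a t * deriv (deriv θ) t + b t * θ t) = V₁ * θ 0 - V₀ * deriv θ 0) :
    ∀ t, 0 ≤ t → a t = V₀ + V₁ * t - ∫ s in (0 : ℝ)..t, ∫ r in (0 : ℝ)..s, b r := by
  set B : ℝ → ℝ := fun s => ∫ r in (0 : ℝ)..s, b r with hBdef
  have hB : Continuous B := intervalIntegral.continuous_primitive hb 0
  set C : ℝ → ℝ := fun t => ∫ s in (0 : ℝ)..t, B s with hCdef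
  have hC : Continuous C :=
    intervalIntegral.continuous_primitive (fun s t => hB.intervalIntegrable s t) 0
  have hA : ContinuousOn (fun t => a t - V₀ - V₁ * t + C t) (Ici 0) := by fun_prop
  have key : ∀ θ : ℝ → ℝ, ContDiff ℝ ∞ θ → HasCompactSupport θ →
      ∫ t in Ioi 0, (a t - V₀ - V₁ * t + C t) * deriv (deriv θ) t = 0 := by
    intro θ hθ hc
    obtain ⟨R₀, hR₀⟩ := hc.isCompact.isBounded.subset_closedBall 0
    obtain ⟨R, hR, hRR⟩ : ∃ R : ℝ, 0 < R ∧ R₀ < R := ⟨max R₀ 0 + 1, by positivity, by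
      linarith [le_max_left R₀ 0]⟩
    have hsub : ∀ t, R ≤ t → t ∉ tsupport θ := by
      intro t ht hmem
      have := hR₀ hmem
      rw [Metric.mem_closedBall, Real.dist_eq, sub_zero] at this
      linarith [le_abs_self t]
    have hsub' : ∀ t, R ≤ t → t ∉ tsupport (deriv θ) := fun t ht h =>
      hsub t ht (tsupport_deriv_subset h)
    have z0 : ∀ t, R ≤ t → θ t = 0 := fun t ht => image_eq_zero_of_notMem_tsupport (hsub t ht)
    have z1 : ∀ t, R ≤ t → deriv θ t = 0 := fun t ht =>
      image_eq_zero_of_notMem_tsupport (hsub' t ht)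
    have z2 : ∀ t, R ≤ t → deriv (deriv θ) t = 0 := fun t ht =>
      image_eq_zero_of_notMem_tsupport (fun h => hsub' t ht (tsupport_deriv_subset h))
    have hθ' : ContDiff ℝ ∞ (deriv θ) := (contDiff_infty_iff_deriv.1 hθ).2
    have hθ'' : Continuous (deriv (deriv θ)) := hθ'.continuous_deriv (by simp)
    have toInt : ∀ F : ℝ → ℝ, (∀ t, R ≤ t → F t = 0) →
        ∫ t in Ioi 0, F t = ∫ t in (0 : ℝ)..R, F t := by
      intro F hF
      rw [intervalIntegral.integral_of_le hR.le]
      refine (setIntegral_eq_of_subset_of_forall_sdiff_eq_zero measurableSet_Ioi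
        Ioc_subset_Ioi_self fun t ht => hF t ?_)
      by_contra hlt
      exact ht.2 ⟨ht.1, (not_le.1 hlt).le⟩
    have hθ1 : ContDiff ℝ 1 θ := hθ.of_le (by simp)
    have hθ'1 : ContDiff ℝ 1 (deriv θ) := hθ'.of_le (by simp)
    have e0 := h θ hθ hc
    rw [toInt _ (fun t ht => by rw [z0 t ht, z2 t ht]; simp)] at e0
    rw [toInt _ (fun t ht => by rw [z2 t ht]; simp)]
    have haR : ContinuousOn a (uIcc 0 R) := ha.mono (by
      rw [uIcc_of_le hR.le]; exact Icc_subset_Ici_self)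
    have i1 : IntervalIntegrable (fun t => a t * deriv (deriv θ) t) volume 0 R :=
      (haR.mul hθ''.continuousOn).intervalIntegrable
    have i2 : IntervalIntegrable (fun t => b t * θ t) volume 0 R :=
      (hb 0 R).mul_continuousOn hθ.continuous.continuousOn
    rw [intervalIntegral.integral_add i1 i2] at e0
    have e1 : ∫ t in (0 : ℝ)..R, deriv (deriv θ) t = -deriv θ 0 := by
      rw [intervalIntegral.integral_deriv_eq_sub
        (fun t _ => hθ'.differentiable (by simp) t) (hθ''.intervalIntegrable _ _), z1 R le_rfl]
      ring
    have e2 : ∫ t in (0 : ℝ)..R, t * deriv (deriv θ) t = θ 0 := by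
      have := integral_primitive_mul_deriv (b := fun _ => (1 : ℝ)) (R := R)
        (continuous_const.intervalIntegrable _ _) hθ'1 (z1 R le_rfl)
      simp only [intervalIntegral.integral_const, sub_zero, smul_eq_mul, mul_one, one_mul] at this
      rw [this, intervalIntegral.integral_deriv_eq_sub
        (fun t _ => hθ.differentiable (by simp) t)
        (hθ'.continuous.intervalIntegrable _ _), z0 R le_rfl]
      ring
    have e3 : ∫ t in (0 : ℝ)..R, C t * deriv (deriv θ) t = ∫ t in (0 : ℝ)..R, b t * θ t := by
      rw [integral_primitive_mul_deriv (hB.intervalIntegrable _ _) hθ'1 (z1 R le_rfl),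
        integral_primitive_mul_deriv (hb 0 R) hθ1 (z0 R le_rfl), neg_neg]
    have i3 : IntervalIntegrable (fun t => V₀ * deriv (deriv θ) t) volume 0 R :=
      (continuous_const.mul hθ'').intervalIntegrable _ _
    have i4 : IntervalIntegrable (fun t => V₁ * (t * deriv (deriv θ) t)) volume 0 R :=
      (continuous_const.mul (continuous_id.mul hθ'')).intervalIntegrable _ _
    have i5 : IntervalIntegrable (fun t => C t * deriv (deriv θ) t) volume 0 R :=
      (hC.mul hθ'').intervalIntegrable _ _
    have : (fun t => (a t - V₀ - V₁ * t + C t) * deriv (deriv θ) t) = fun t =>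
        a t * deriv (deriv θ) t - V₀ * deriv (deriv θ) t - V₁ * (t * deriv (deriv θ) t)
          + C t * deriv (deriv θ) t := by
      ext t; ring
    rw [this, intervalIntegral.integral_add ((i1.sub i3).sub i4) i5,
      intervalIntegral.integral_sub (i1.sub i3) i4, intervalIntegral.integral_sub i1 i3,
      intervalIntegral.integral_const_mul, intervalIntegral.integral_const_mul, e1, e2, e3]
    linarith
  have hae : ∀ᵐ t : ℝ, t ∈ Ioi (0 : ℝ) → a t - V₀ - V₁ * t + C t = 0 := by
    refine isOpen_Ioi.ae_eq_zero_of_integral_contDiff_smul_eq_zero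
      ((hA.mono Ioi_subset_Ici_self).locallyIntegrableOn measurableSet_Ioi) ?_
    intro g hg hc hs
    obtain ⟨θ₁, hθ₁, hc₁, hd₁⟩ := exists_antideriv_test hg hc
    obtain ⟨θ, hθ, hcθ, hd⟩ := exists_antideriv_test hθ₁ hc₁
    rw [← key θ hθ hcθ, ← setIntegral_eq_integral_of_forall_compl_eq_zero (s := Ioi (0 : ℝ))]
    · refine setIntegral_congr_fun measurableSet_Ioi fun t ht => ?_
      have : deriv θ =ᶠ[𝓝 t] θ₁ := by
        filter_upwards [lt_mem_nhds (show (0 : ℝ) < t from ht)] with s hs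
        exact hd s hs
      simp only [this.deriv_eq, hd₁ t ht, smul_eq_mul, mul_comm]
    · intro t ht
      rw [image_eq_zero_of_notMem_tsupport (fun h => ht (hs h)), zero_smul]
  have hae' : (fun t => a t - V₀ - V₁ * t + C t) =ᵐ[volume.restrict (Ici (0 : ℝ))] fun _ => 0 := by
    rw [← restrict_Ioi_eq_restrict_Ici, EventuallyEq, ae_restrict_iff' measurableSet_Ioi]
    exact hae
  have hall := Measure.eqOn_of_ae_eq hae' hA continuousOn_const (by
    rw [interior_Ici, closure_Ioi])
  intro t ht
  have := hall ht
  simp only at this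
  linarith

/-! ### Integrability on bounded time slabs, and sections at fixed time. -/

theorem restrict_prod_eq (I J : Set ℝ) : (volume : Measure (ℝ × ℝ)).restrict (I ×ˢ J) =
    (volume.restrict I).prod (volume.restrict J) := by
  rw [Measure.volume_eq_prod, Measure.prod_restrict]

theorem MemLinftyL2.integrableOn {L : ℝ} {g : ℝ × ℝ → ℝ} (h : MemLinftyL2 (Ioi 0) L g) (T : ℝ) :
    IntegrableOn g (Ioo 0 T ×ˢ Ioo 0 L) := by
  obtain ⟨hm, C, hC⟩ := h
  have hm' : AEStronglyMeasurable g (volume.restrict (Ioo 0 T ×ˢ Ioo 0 L)) :=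
    hm.mono_measure (Measure.restrict_mono (Set.prod_mono Ioo_subset_Ioi_self Subset.rfl) le_rfl)
  refine ⟨hm', ?_⟩
  rw [restrict_prod_eq] at hm'
  rw [hasFiniteIntegral_iff_enorm, restrict_prod_eq, lintegral_prod _ hm'.enorm]
  set K : ENNReal := C * (volume.restrict (Ioo 0 L)) univ ^ (1 / (1 : ENNReal).toReal
    - 1 / (2 : ENNReal).toReal)
  have hK : K < ⊤ := ENNReal.mul_lt_top ENNReal.coe_lt_top
    (ENNReal.rpow_lt_top_of_nonneg (by norm_num) (by simp))
  calc ∫⁻ t in Ioo 0 T, ∫⁻ x in Ioo 0 L, ‖g (t, x)‖ₑ ≤ ∫⁻ _ in Ioo 0 T, K := by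
        refine lintegral_mono_ae ?_
        filter_upwards [hm'.prodMk_left, ae_restrict_of_ae_restrict_of_subset
          (Ioo_subset_Ioi_self (a := T) (b := (0 : ℝ))) hC] with t h1 h2
        rw [← eLpNorm_one_eq_lintegral_enorm]
        refine (eLpNorm_le_eLpNorm_mul_rpow_measure_univ (q := 2) (by norm_num) h1).trans ?_
        exact mul_le_mul_left h2 _
    _ < ⊤ := by
        rw [lintegral_const]
        exact ENNReal.mul_lt_top hK (by simp)

theorem continuousOn_integral_section {L : ℝ} (hL : 0 < L) {F : ℝ × ℝ → ℝ}
    (hF : ContinuousOn F (closedStrip L)) :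
    ContinuousOn (fun t => ∫ x in Ioo 0 L, F (t, x)) (Ici 0) := by
  -- Clamping `t` and `x` extends `F` from the closed strip to a continuous function on the plane.
  have h1 : Continuous (Function.uncurry fun t x : ℝ => F (max t 0, max 0 (min x L))) := by
    refine hF.comp_continuous (f := fun z : ℝ × ℝ => (max z.1 0, max 0 (min z.2 L)))
      (by fun_prop) fun z => ?_
    exact ⟨mem_Ici.2 (le_max_right _ _), le_max_left _ _, max_le hL.le (min_le_right _ _)⟩
  have h2 := continuous_parametric_integral_of_continuous (μ := volume) h1
    (isCompact_Icc (a := (0 : ℝ)) (b := L))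
  refine h2.continuousOn.congr fun t ht => ?_
  simp only
  rw [integral_Icc_eq_integral_Ioo]
  refine setIntegral_congr_fun measurableSet_Ioo fun x hx => ?_
  simp only [max_eq_left (show (0 : ℝ) ≤ t from ht), min_eq_left hx.2.le, max_eq_right hx.1.le]

theorem continuousOn_section {L : ℝ} {F : ℝ × ℝ → ℝ} (hF : ContinuousOn F (closedStrip L)) {t : ℝ}
    (ht : 0 ≤ t) : ContinuousOn (fun x => F (t, x)) (Icc 0 L) :=
  hF.comp (by fun_prop) fun _ hx => mk_mem_prod ht hx

theorem integrableOn_section {L : ℝ} {F : ℝ × ℝ → ℝ} (hF : ContinuousOn F (closedStrip L)) {t : ℝ}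
    (ht : 0 ≤ t) : IntegrableOn (fun x => F (t, x)) (Ioo 0 L) :=
  ((continuousOn_section hF ht).integrableOn_compact isCompact_Icc).mono_set Ioo_subset_Icc_self

/-! ### Projection of the equation onto a spatial profile. -/

theorem partialT_mul {θ ψ : ℝ → ℝ} (hθ : Differentiable ℝ θ) (hψ : Differentiable ℝ ψ) :
    partialT (fun z => θ z.1 * ψ z.2) = fun z => deriv θ z.1 * ψ z.2 := by
  ext z
  have h1 : HasFDerivAt (fun z : ℝ × ℝ => θ z.1) _ z :=
    (hθ z.1).hasDerivAt.comp_hasFDerivAt z (hasFDerivAt_fst (𝕜 := ℝ) (E := ℝ) (F := ℝ))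
  have h2 : HasFDerivAt (fun z : ℝ × ℝ => ψ z.2) _ z :=
    (hψ z.2).hasDerivAt.comp_hasFDerivAt z (hasFDerivAt_snd (𝕜 := ℝ) (E := ℝ) (F := ℝ))
  rw [partialT, (h1.fun_mul h2).fderiv]
  simp [mul_comm]

theorem partialX_mul {θ ψ : ℝ → ℝ} (hθ : Differentiable ℝ θ) (hψ : Differentiable ℝ ψ) :
    partialX (fun z => θ z.1 * ψ z.2) = fun z => θ z.1 * deriv ψ z.2 := by
  ext z
  have h1 : HasFDerivAt (fun z : ℝ × ℝ => θ z.1) _ z :=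
    (hθ z.1).hasDerivAt.comp_hasFDerivAt z (hasFDerivAt_fst (𝕜 := ℝ) (E := ℝ) (F := ℝ))
  have h2 : HasFDerivAt (fun z : ℝ × ℝ => ψ z.2) _ z :=
    (hψ z.2).hasDerivAt.comp_hasFDerivAt z (hasFDerivAt_snd (𝕜 := ℝ) (E := ℝ) (F := ℝ))
  rw [partialX, (h1.fun_mul h2).fderiv]
  simp

/-- The forcing term obtained by testing the equation with a profile `ψ` in space. -/
noncomputable def forcing (κ₁ L : ℝ) (u h : ℝ × ℝ → ℝ) (ψ : ℝ → ℝ) : ℝ → ℝ :=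
  indicator (Ioi 0) fun t => ∫ x in Ioo 0 L,
    (κ₁ ^ 2 * weakDxx L u (t, x) * deriv (deriv ψ) x + h (t, x) * ψ x)

section Projection

variable {κ₁ L : ℝ} {u h : ℝ × ℝ → ℝ} {ψ : ℝ → ℝ}

theorem integrableOn_mul_continuous {F G : ℝ × ℝ → ℝ} {T : ℝ}
    (hF : IntegrableOn F (Ioo 0 T ×ˢ Ioo 0 L)) (hG : Continuous G) :
    IntegrableOn (fun z => F z * G z) (Ioo 0 T ×ˢ Ioo 0 L) :=
  hF.mul_continuousOn_of_subset hG.continuousOn (measurableSet_Ioo.prod measurableSet_Ioo)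
    (isCompact_Icc.prod isCompact_Icc) (Set.prod_mono Ioo_subset_Icc_self Ioo_subset_Icc_self)

theorem intervalIntegrable_forcing (hw : ∀ T, IntegrableOn (weakDxx L u) (Ioo 0 T ×ˢ Ioo 0 L))
    (hh : ∀ T, IntegrableOn h (Ioo 0 T ×ˢ Ioo 0 L)) (hψ : ContDiff ℝ ∞ ψ) (s t : ℝ) :
    IntervalIntegrable (forcing κ₁ L u h ψ) volume s t := by
  have hψ' : ContDiff ℝ ∞ (deriv ψ) := (contDiff_infty_iff_deriv.1 hψ).2
  have hψ'' : Continuous (deriv (deriv ψ)) := hψ'.continuous_deriv (by simp)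
  -- The forcing is zero for `t ≤ 0`, so integrability on `Ioo 0 T` is enough.
  have key : ∀ T, IntegrableOn (forcing κ₁ L u h ψ) (Iio T) := by
    intro T
    have h1 : IntegrableOn (fun z : ℝ × ℝ =>
        κ₁ ^ 2 * weakDxx L u z * deriv (deriv ψ) z.2 + h z * ψ z.2) (Ioo 0 T ×ˢ Ioo 0 L) :=
      (integrableOn_mul_continuous ((hw T).const_mul _) (by fun_prop)).add
        (integrableOn_mul_continuous (hh T) (hψ.continuous.comp continuous_snd))
    rw [IntegrableOn, restrict_prod_eq] at h1
    have h2 := h1.integral_prod_left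
    rw [forcing, IntegrableOn, integrable_indicator_iff measurableSet_Ioi, IntegrableOn,
      Measure.restrict_restrict measurableSet_Ioi, Ioi_inter_Iio]
    exact h2
  rw [intervalIntegrable_iff]
  exact (key (max s t + 1)).mono_set fun r hr => lt_of_le_of_lt hr.2 (lt_add_one _)

/-- Testing with `θ(t) ψ(x)` and applying Fubini reduces the weak formulation to a weak second-order
equation in time. The conditions on `ψ'` at `0` and `L` make the product admissible. -/
theorem integral_mul_eq_of_isWeakSolution {v₀ v₁ : ℝ → ℝ} {c₀ c₁ : ℝ} (hL : 0 < L)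
    (hu : ContinuousOn u (closedStrip L))
    (hw : ∀ T, IntegrableOn (weakDxx L u) (Ioo 0 T ×ˢ Ioo 0 L))
    (hh : ∀ T, IntegrableOn h (Ioo 0 T ×ˢ Ioo 0 L))
    (hv₀ : ∀ᵐ x ∂(volume.restrict (Ioo 0 L)), v₀ x = c₀)
    (hv₁ : ∀ᵐ x ∂(volume.restrict (Ioo 0 L)), v₁ x = c₁)
    (hweak : IsWeakSolution κ₁ L v₀ v₁ u h)
    (hψ : ContDiff ℝ ∞ ψ) (hψc : HasCompactSupport ψ) (hψ0 : deriv ψ 0 = 0) (hψL : deriv ψ L = 0)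
    {t : ℝ} (ht : 0 ≤ t) :
    ∫ x in Ioo 0 L, u (t, x) * ψ x = c₀ * (∫ x in Ioo 0 L, ψ x) + c₁ * (∫ x in Ioo 0 L, ψ x) * t
      - ∫ s in (0 : ℝ)..t, ∫ r in (0 : ℝ)..s, forcing κ₁ L u h ψ r := by
  have hψ' : ContDiff ℝ ∞ (deriv ψ) := (contDiff_infty_iff_deriv.1 hψ).2
  have hψ'' : Continuous (deriv (deriv ψ)) := hψ'.continuous_deriv (by simp)
  have hψd := hψ.differentiable (by simp)
  have hψd' := hψ'.differentiable (by simp)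
  have hψcont := hψ.continuous
  have ha : ContinuousOn (fun t => ∫ x in Ioo 0 L, u (t, x) * ψ x) (Ici 0) :=
    continuousOn_integral_section hL (F := fun z => u z * ψ z.2) (by fun_prop)
  refine eq_of_weak_second_deriv ha (intervalIntegrable_forcing hw hh hψ) ?_ t ht
  intro θ hθ hθc
  have hθ' : ContDiff ℝ ∞ (deriv θ) := (contDiff_infty_iff_deriv.1 hθ).2
  have hθ'' : Continuous (deriv (deriv θ)) := hθ'.continuous_deriv (by simp)
  have hθd := hθ.differentiable (by simp)
  have hθd' := hθ'.differentiable (by simp)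
  have hθcont := hθ.continuous
  obtain ⟨R, hR⟩ := hθc.isCompact.isBounded.subset_closedBall 0
  have hsub : ∀ t, R < t → t ∉ tsupport θ := by
    intro t ht hmem
    have := hR hmem
    rw [Metric.mem_closedBall, Real.dist_eq, sub_zero] at this
    linarith [le_abs_self t]
  have z0 : ∀ t, R < t → θ t = 0 := fun t ht => image_eq_zero_of_notMem_tsupport (hsub t ht)
  have z2 : ∀ t, R < t → deriv (deriv θ) t = 0 := fun t ht =>
    image_eq_zero_of_notMem_tsupport
      (fun h => hsub t ht (tsupport_deriv_subset (tsupport_deriv_subset h)))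
  have h0 := hweak (fun z => θ z.1 * ψ z.2)
    ((hθ.comp contDiff_fst).mul (hψ.comp contDiff_snd))
    (HasCompactSupport.intro (hθc.isCompact.prod hψc.isCompact) (by
      rintro ⟨t, x⟩ hz
      by_cases h1 : t ∈ tsupport θ
      · have h2 : x ∉ tsupport ψ := fun h2 => hz ⟨h1, h2⟩
        simp [image_eq_zero_of_notMem_tsupport h2]
      · simp [image_eq_zero_of_notMem_tsupport h1]))
    (by simp [partialX_mul hθd hψd, hψ0]) (by simp [partialX_mul hθd hψd, hψL])
  rw [partialT_mul hθd hψd, partialT_mul hθd' hψd, partialX_mul hθd hψd,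
    partialX_mul hθd hψd'] at h0
  have ext : ∀ F : ℝ × ℝ → ℝ, IntegrableOn F (Ioo 0 (R + 1) ×ˢ Ioo 0 L) →
      (∀ z, R < z.1 → F z = 0) → IntegrableOn F (strip L) := by
    intro F hF hz
    refine hF.of_forall_sdiff_eq_zero (isOpen_strip L).measurableSet fun z hz' => hz z ?_
    by_contra hlt
    exact hz'.2 ⟨⟨hz'.1.1, by linarith⟩, hz'.1.2⟩
  have huI : IntegrableOn u (Ioo 0 (R + 1) ×ˢ Ioo 0 L) :=
    ((hu.mono (Set.prod_mono Icc_subset_Ici_self Subset.rfl)).integrableOn_compact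
      (isCompact_Icc.prod isCompact_Icc)).mono_set
      (Set.prod_mono Ioo_subset_Icc_self Ioo_subset_Icc_self)
  have I1 : IntegrableOn (fun z : ℝ × ℝ => u z * (deriv (deriv θ) z.1 * ψ z.2)) (strip L) :=
    ext _ (integrableOn_mul_continuous huI (by fun_prop)) fun z hz => by rw [z2 _ hz]; simp
  have I2 : IntegrableOn (fun z : ℝ × ℝ =>
      θ z.1 * (κ₁ ^ 2 * weakDxx L u z * deriv (deriv ψ) z.2 + h z * ψ z.2)) (strip L) := by
    refine ext _ ?_ fun z hz => by rw [z0 _ hz]; simp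
    have := (integrableOn_mul_continuous ((hw (R + 1)).const_mul (κ₁ ^ 2))
        (G := fun z => θ z.1 * deriv (deriv ψ) z.2) (by fun_prop)).add
      (integrableOn_mul_continuous (hh (R + 1)) (G := fun z => θ z.1 * ψ z.2) (by fun_prop))
    refine this.congr (Eventually.of_forall fun z => ?_)
    simp only [Pi.add_apply]
    ring
  have e1 : ∫ z in strip L, (u z * (deriv (deriv θ) z.1 * ψ z.2)
      + κ₁ ^ 2 * weakDxx L u z * (θ z.1 * deriv (deriv ψ) z.2) + h z * (θ z.1 * ψ z.2))
      = (∫ z in strip L, u z * (deriv (deriv θ) z.1 * ψ z.2)) + ∫ z in strip L,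
        θ z.1 * (κ₁ ^ 2 * weakDxx L u z * deriv (deriv ψ) z.2 + h z * ψ z.2) := by
    rw [← integral_add I1 I2]
    congr 1
    ext z
    ring
  rw [IntegrableOn, strip, restrict_prod_eq] at I1 I2
  have J1 := I1.integral_prod_left
  have J2 := I2.integral_prod_left
  rw [e1, strip, restrict_prod_eq, integral_prod _ I1, integral_prod _ I2,
    ← integral_add J1 J2] at h0
  have e2 : ∫ x in Ioo 0 L, v₁ x * (θ 0 * ψ x) = c₁ * (∫ x in Ioo 0 L, ψ x) * θ 0 := by
    rw [← integral_const_mul, ← integral_mul_const]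
    refine integral_congr_ae ?_
    filter_upwards [hv₁] with x hx
    rw [hx]; ring
  have e3 : ∫ x in Ioo 0 L, v₀ x * (deriv θ 0 * ψ x) = c₀ * (∫ x in Ioo 0 L, ψ x) * deriv θ 0 := by
    rw [← integral_const_mul, ← integral_mul_const]
    refine integral_congr_ae ?_
    filter_upwards [hv₀] with x hx
    rw [hx]; ring
  have e4 : ∫ t in Ioi 0, ((∫ x in Ioo 0 L, u (t, x) * ψ x) * deriv (deriv θ) t
      + forcing κ₁ L u h ψ t * θ t) = ∫ t in Ioi 0,
      ((∫ x in Ioo 0 L, u (t, x) * (deriv (deriv θ) t * ψ x)) + ∫ x in Ioo 0 L,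
        θ t * (κ₁ ^ 2 * weakDxx L u (t, x) * deriv (deriv ψ) x + h (t, x) * ψ x)) := by
    refine setIntegral_congr_fun measurableSet_Ioi fun t ht => ?_
    simp only [forcing, indicator_of_mem ht]
    rw [integral_const_mul, mul_comm (θ t), ← integral_mul_const]
    congr 2
    ext x
    ring
  rw [e4]
  simp only [e2, e3] at h0
  linarith

end Projection

/-! ### The adhesive potential and its subdifferential. -/

section Potential

variable {κ₂ s ξ : ℝ}

theorem potential_eq_of_abs_le (hs : |s| ≤ 1) : potential κ₂ s = κ₂ ^ 2 * s ^ 2 / 2 := if_pos hs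

theorem potential_eq_of_le_abs (hs : 1 ≤ |s|) : potential κ₂ s = κ₂ ^ 2 / 2 := by
  rcases hs.eq_or_lt with h | h
  · rw [potential_eq_of_abs_le h.ge, ← sq_abs s, ← h]; ring
  · exact if_neg (not_le.2 h)

/-- This form makes the Lipschitz bound a difference of squares: the two minima sum to at most `2`,
which absorbs the factor `1 / 2`. -/
theorem potential_eq_min (κ₂ s : ℝ) : potential κ₂ s = κ₂ ^ 2 / 2 * (min |s| 1) ^ 2 := by
  rcases le_total |s| 1 with h | h
  · rw [potential_eq_of_abs_le h, min_eq_left h, sq_abs]; ring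
  · rw [potential_eq_of_le_abs h, min_eq_right h]; ring

theorem lipschitzWith_potential (κ₂ : ℝ) :
    LipschitzWith (Real.toNNReal (κ₂ ^ 2)) (potential κ₂) := by
  refine LipschitzWith.of_dist_le_mul fun a b => ?_
  rw [Real.dist_eq, Real.dist_eq, Real.coe_toNNReal _ (sq_nonneg _), potential_eq_min,
    potential_eq_min]
  have h1 : |min |a| 1 - min |b| 1| ≤ |a - b| :=
    (abs_min_sub_min_le_max |a| 1 |b| 1).trans (by
      rw [sub_self, abs_zero, max_eq_left (abs_nonneg _)]
      exact abs_abs_sub_abs_le _ _)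
  have h2 : |min |a| 1 + min |b| 1| ≤ 2 := by
    rw [abs_of_nonneg (by positivity)]
    linarith [min_le_right |a| 1, min_le_right |b| 1]
  calc |κ₂ ^ 2 / 2 * min |a| 1 ^ 2 - κ₂ ^ 2 / 2 * min |b| 1 ^ 2|
      = κ₂ ^ 2 / 2 * (|min |a| 1 - min |b| 1| * |min |a| 1 + min |b| 1|) := by
        rw [← abs_mul, ← abs_of_nonneg (show 0 ≤ κ₂ ^ 2 / 2 by positivity), ← abs_mul,
          abs_of_nonneg (show 0 ≤ κ₂ ^ 2 / 2 by positivity)]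
        congr 1; ring
    _ ≤ κ₂ ^ 2 / 2 * (|a - b| * 2) := by gcongr
    _ = κ₂ ^ 2 * |a - b| := by ring

theorem continuous_potential (κ₂ : ℝ) : Continuous (potential κ₂) :=
  (lipschitzWith_potential κ₂).continuous

theorem abs_le_of_mem_subdifferential (h : ξ ∈ subdifferential (potential κ₂) s) :
    |ξ| ≤ κ₂ ^ 2 := by
  have : subdifferential (potential κ₂) s ⊆ Metric.closedBall 0 (κ₂ ^ 2) := by
    refine convexHull_min ?_ (convex_closedBall _ _)
    rintro η ⟨y, -, -, hy⟩
    refine Metric.isClosed_closedBall.mem_of_tendsto hy (Eventually.of_forall fun n => ?_)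
    rw [mem_closedBall_zero_iff]
    exact (norm_deriv_le_of_lipschitz (lipschitzWith_potential κ₂)).trans_eq
      (Real.coe_toNNReal _ (sq_nonneg _))
  simpa [Real.norm_eq_abs] using this h

/-- Where the derivative is continuous, all limits of nearby derivatives coincide, and a singleton
is convex. -/
theorem subdifferential_subset_singleton {f f' : ℝ → ℝ} (h : ∀ᶠ y in 𝓝 s, HasDerivAt f (f' y) y)
    (hc : ContinuousAt f' s) : subdifferential f s ⊆ {f' s} := by
  refine convexHull_min ?_ (convex_singleton _)
  rintro η ⟨y, hy, -, hη⟩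
  refine tendsto_nhds_unique hη ((hc.tendsto.comp hy).congr' ?_)
  filter_upwards [hy.eventually h] with n hn
  exact hn.deriv.symm

theorem eq_of_mem_subdifferential_of_abs_lt (hs : |s| < 1)
    (h : ξ ∈ subdifferential (potential κ₂) s) : ξ = κ₂ ^ 2 * s := by
  refine subdifferential_subset_singleton (f' := fun y => κ₂ ^ 2 * y) ?_ (by fun_prop) h
  have hO : IsOpen {y : ℝ | |y| < 1} := isOpen_lt continuous_abs continuous_const
  filter_upwards [hO.mem_nhds hs] with y hy
  have h1 : HasDerivAt (fun y : ℝ => κ₂ ^ 2 * y ^ 2 / 2) (κ₂ ^ 2 * y) y := by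
    convert! ((hasDerivAt_pow 2 y).const_mul (κ₂ ^ 2)).div_const 2 using 1
    norm_num; ring
  refine h1.congr_of_eventuallyEq ?_
  filter_upwards [hO.mem_nhds hy] with r hr
  exact potential_eq_of_abs_le (le_of_lt hr)

theorem eq_zero_of_mem_subdifferential_of_lt_abs (hs : 1 < |s|)
    (h : ξ ∈ subdifferential (potential κ₂) s) : ξ = 0 := by
  refine subdifferential_subset_singleton (f' := fun _ => 0) ?_ (by fun_prop) h
  have hO : IsOpen {y : ℝ | 1 < |y|} := isOpen_lt continuous_const continuous_abs
  filter_upwards [hO.mem_nhds hs] with y hy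
  refine (hasDerivAt_const y (κ₂ ^ 2 / 2)).congr_of_eventuallyEq ?_
  filter_upwards [hO.mem_nhds hy] with r hr
  exact potential_eq_of_le_abs (le_of_lt hr)

end Potential

theorem integrableOn_of_mem_subdifferential {κ₂ L : ℝ} {u h : ℝ × ℝ → ℝ}
    (hm : AEStronglyMeasurable h (volume.restrict (strip L)))
    (hh : ∀ᵐ z ∂(volume.restrict (strip L)), h z ∈ subdifferential (potential κ₂) (u z)) (T : ℝ) :
    IntegrableOn h (Ioo 0 T ×ˢ Ioo 0 L) := by
  have hsub : Ioo 0 T ×ˢ Ioo 0 L ⊆ strip L := Set.prod_mono Ioo_subset_Ioi_self Subset.rfl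
  refine IntegrableOn.of_bound (C := κ₂ ^ 2) ?_
    (hm.mono_measure (Measure.restrict_mono hsub le_rfl)) ?_
  · exact ((Metric.isBounded_Ioo 0 T).prod (Metric.isBounded_Ioo 0 L)).measure_lt_top
  · filter_upwards [ae_restrict_of_ae_restrict_of_subset hsub hh] with z hz
    exact abs_le_of_mem_subdifferential hz

/-! ### The energy bound for constant data. -/

section Energy

variable {κ₁ κ₂ L : ℝ} {v₀ v₁ : ℝ → ℝ} {u : ℝ × ℝ → ℝ}

theorem initialEnergy_of_const (hL : 0 < L) {c₀ c₁ : ℝ} (hc₀ : |c₀| ≤ 1) (hH : MemH2 L v₀)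
    (hv₀ : ∀ᵐ x ∂(volume.restrict (Ioo 0 L)), v₀ x = c₀)
    (hv₁ : ∀ᵐ x ∂(volume.restrict (Ioo 0 L)), v₁ x = c₁) :
    initialEnergy κ₁ κ₂ L v₀ v₁ = L * (c₁ ^ 2 / 2 + κ₂ ^ 2 * c₀ ^ 2 / 2) := by
  have h1 : ∀ᵐ x ∂(volume.restrict (Ioo 0 L)), weakDeriv L v₀ x = 0 :=
    weakDerivAlong_ae_eq_zero_of_const isOpen_Ioo hH.2.1 hv₀
  have h2 : ∀ᵐ x ∂(volume.restrict (Ioo 0 L)), weakDeriv L (weakDeriv L v₀) x = 0 :=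
    weakDerivAlong_ae_eq_zero_of_const isOpen_Ioo hH.2.2.2.1 h1
  have : ∀ᵐ x ∂(volume.restrict (Ioo 0 L)), ((v₁ x) ^ 2
      + κ₁ ^ 2 * (weakDeriv L (weakDeriv L v₀) x) ^ 2) / 2 + potential κ₂ (v₀ x)
      = c₁ ^ 2 / 2 + κ₂ ^ 2 * c₀ ^ 2 / 2 := by
    filter_upwards [hv₀, hv₁, h2] with x e0 e1 e2
    rw [e0, e1, e2, potential_eq_of_abs_le hc₀]
    ring
  rw [initialEnergy, stateEnergy, integral_congr_ae this]
  simp [hL.le]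

/-- Dropping the nonnegative bending energy leaves an integrand continuous up to the boundary, so
the bound passes from almost every time to every `t ≥ 0`. -/
theorem integral_timeDeriv_sq_add_potential_le (hL : 0 < L)
    (hu : IsDissipativeSolution κ₁ κ₂ L v₀ v₁ u) (hC1 : ContDiffOn ℝ 1 u (closedStrip L))
    {t : ℝ} (ht : 0 ≤ t) :
    ∫ x in Ioo 0 L, (timeDeriv L u (t, x) ^ 2 / 2 + potential κ₂ (u (t, x)))
      ≤ initialEnergy κ₁ κ₂ L v₀ v₁ := by
  set K := initialEnergy κ₁ κ₂ L v₀ v₁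
  have hg := continuousOn_timeDeriv hL hC1
  have hF : ContinuousOn (fun z => timeDeriv L u z ^ 2 / 2 + potential κ₂ (u z)) (closedStrip L) :=
    ((hg.pow 2).div_const 2).add ((continuous_potential κ₂).comp_continuousOn hu.continuousOn)
  have hcont := continuousOn_integral_section hL hF
  have hdt := weakDt_ae_eq_timeDeriv hC1 hu.exists_dt
  rw [strip, restrict_prod_eq] at hdt
  obtain ⟨hm, C, hC⟩ := hu.dxx_mem
  rw [restrict_prod_eq] at hm
  have hae : ∀ᵐ t ∂(volume.restrict (Ioi (0 : ℝ))),
      ∫ x in Ioo 0 L, (timeDeriv L u (t, x) ^ 2 / 2 + potential κ₂ (u (t, x))) ≤ K := by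
    filter_upwards [hu.dissipation, Measure.ae_ae_of_ae_prod hdt, hm.prodMk_left, hC,
      ae_restrict_mem measurableSet_Ioi] with t h1 h2 h3 h4 h5
    refine le_trans ?_ h1
    have i1 := integrableOn_section hF (le_of_lt h5)
    have i2 : IntegrableOn (fun x => weakDxx L u (t, x) ^ 2) (Ioo 0 L) :=
      MemLp.integrable_sq ⟨h3, h4.trans_lt ENNReal.coe_lt_top⟩
    have e : energy κ₁ κ₂ L u t = ∫ x in Ioo 0 L, ((timeDeriv L u (t, x) ^ 2 / 2
        + potential κ₂ (u (t, x))) + κ₁ ^ 2 / 2 * weakDxx L u (t, x) ^ 2) := by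
      rw [energy, stateEnergy]
      refine integral_congr_ae ?_
      filter_upwards [h2] with x hx
      rw [hx]
      ring
    rw [e, integral_add i1 (i2.const_mul _)]
    refine le_add_of_nonneg_right (integral_nonneg fun x => ?_)
    simp only [Pi.zero_apply]
    positivity
  -- Written as an equality `max _ K = K` of continuous functions, the almost-everywhere inequality
  -- extends to all times.
  have hmax : (fun t => max (∫ x in Ioo 0 L, (timeDeriv L u (t, x) ^ 2 / 2
      + potential κ₂ (u (t, x)))) K) =ᵐ[volume.restrict (Ici (0 : ℝ))] fun _ => K := by
    rw [← restrict_Ioi_eq_restrict_Ici]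
    filter_upwards [hae] with t ht
    exact max_eq_right ht
  exact max_eq_right_iff.1 (Measure.eqOn_of_ae_eq hmax (hcont.sup continuousOn_const)
    continuousOn_const (by rw [interior_Ici, closure_Ioi]) ht)

end Energy

/-! ### The mean equation and the initial trace. -/

theorem exists_cutoff (L : ℝ) : ∃ ψ : ℝ → ℝ, ContDiff ℝ ∞ ψ ∧ HasCompactSupport ψ ∧
    ∀ x ∈ Icc 0 L, ψ =ᶠ[𝓝 x] fun _ => 1 := by
  have hR : 0 < |L| + 1 := by positivity
  let f : ContDiffBump (0 : ℝ) := ⟨|L| + 1, |L| + 2, hR, by linarith⟩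
  refine ⟨f, f.contDiff, f.hasCompactSupport, fun x hx => ?_⟩
  refine f.eventuallyEq_one_of_mem_ball ?_
  rw [Metric.mem_ball, Real.dist_eq, sub_zero, abs_of_nonneg hx.1]
  change x < |L| + 1
  linarith [hx.2, le_abs_self L]

section Mean

variable {κ₁ L : ℝ} {v₀ v₁ : ℝ → ℝ} {u h : ℝ × ℝ → ℝ} {c₀ c₁ : ℝ}

/-- The profile is a cutoff equal to `1` near `[0, L]`: its derivatives vanish there, which makes it
admissible and eliminates the bending term. -/
theorem integral_eq_of_isWeakSolution (hL : 0 < L) (hu : ContinuousOn u (closedStrip L))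
    (hw : ∀ T, IntegrableOn (weakDxx L u) (Ioo 0 T ×ˢ Ioo 0 L))
    (hh : ∀ T, IntegrableOn h (Ioo 0 T ×ˢ Ioo 0 L))
    (hv₀ : ∀ᵐ x ∂(volume.restrict (Ioo 0 L)), v₀ x = c₀)
    (hv₁ : ∀ᵐ x ∂(volume.restrict (Ioo 0 L)), v₁ x = c₁)
    (hweak : IsWeakSolution κ₁ L v₀ v₁ u h) :
    ∃ b : ℝ → ℝ, (∀ s t, IntervalIntegrable b volume s t) ∧
      (∀ t, 0 < t → b t = ∫ x in Ioo 0 L, h (t, x)) ∧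
      ∀ t, 0 ≤ t → ∫ x in Ioo 0 L, u (t, x) = c₀ * L + c₁ * L * t
        - ∫ s in (0 : ℝ)..t, ∫ r in (0 : ℝ)..s, b r := by
  obtain ⟨ψ, hψ, hψc, hψ1⟩ := exists_cutoff L
  have h1 : ∀ x ∈ Ioo 0 L, ψ x = 1 := fun x hx => (hψ1 x (Ioo_subset_Icc_self hx)).eq_of_nhds
  have hd : ∀ x ∈ Icc 0 L, deriv ψ =ᶠ[𝓝 x] fun _ => 0 := fun x hx => by
    simpa using (hψ1 x hx).deriv
  have hdd : ∀ x ∈ Icc 0 L, deriv (deriv ψ) x = 0 := fun x hx => by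
    simp [(hd x hx).deriv_eq]
  refine ⟨forcing κ₁ L u h ψ, intervalIntegrable_forcing hw hh hψ, fun t ht => ?_, fun t ht => ?_⟩
  · rw [forcing, indicator_of_mem (show t ∈ Ioi (0 : ℝ) from ht)]
    refine setIntegral_congr_fun measurableSet_Ioo fun x hx => ?_
    simp only [h1 x hx, hdd x (Ioo_subset_Icc_self hx), mul_zero, zero_add, mul_one]
  · have := integral_mul_eq_of_isWeakSolution hL hu hw hh hv₀ hv₁ hweak hψ hψc
      (hd 0 (left_mem_Icc.2 hL.le)).eq_of_nhds (hd L (right_mem_Icc.2 hL.le)).eq_of_nhds ht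
    have e1 : ∫ x in Ioo 0 L, u (t, x) * ψ x = ∫ x in Ioo 0 L, u (t, x) :=
      setIntegral_congr_fun measurableSet_Ioo fun x hx => by simp only [h1 x hx, mul_one]
    have e2 : ∫ x in Ioo 0 L, ψ x = L := by
      rw [setIntegral_congr_fun measurableSet_Ioo (g := fun _ => 1) fun x hx => h1 x hx]
      simp [hL.le]
    rw [e1, e2] at this
    exact this

/-- The initial displacement is encoded only in the weak formulation. Evaluating the projected
identity at `t = 0`, for profiles supported in `(0, L)`, recovers it pointwise by continuity. -/
theorem eq_const_at_zero_of_isWeakSolution (hL : 0 < L) (hu : ContinuousOn u (closedStrip L))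
    (hw : ∀ T, IntegrableOn (weakDxx L u) (Ioo 0 T ×ˢ Ioo 0 L))
    (hh : ∀ T, IntegrableOn h (Ioo 0 T ×ˢ Ioo 0 L))
    (hv₀ : ∀ᵐ x ∂(volume.restrict (Ioo 0 L)), v₀ x = c₀)
    (hv₁ : ∀ᵐ x ∂(volume.restrict (Ioo 0 L)), v₁ x = c₁)
    (hweak : IsWeakSolution κ₁ L v₀ v₁ u h) : ∀ x ∈ Icc 0 L, u (0, x) = c₀ := by
  have hc : ContinuousOn (fun x => u (0, x)) (Icc 0 L) := continuousOn_section hu le_rfl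
  have hae : ∀ᵐ x : ℝ, x ∈ Ioo 0 L → u (0, x) - c₀ = 0 := by
    refine isOpen_Ioo.ae_eq_zero_of_integral_contDiff_smul_eq_zero
      (((hc.mono Ioo_subset_Icc_self).sub continuousOn_const).locallyIntegrableOn
        measurableSet_Ioo) ?_
    intro ψ hψ hψc hs
    have hz : ∀ x ∉ Ioo 0 L, deriv ψ x = 0 := fun x hx =>
      image_eq_zero_of_notMem_tsupport fun h => hx (hs (tsupport_deriv_subset h))
    have := integral_mul_eq_of_isWeakSolution hL hu hw hh hv₀ hv₁ hweak hψ hψc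
      (hz 0 (by simp)) (hz L (by simp)) le_rfl
    rw [intervalIntegral.integral_same, mul_zero, add_zero, sub_zero] at this
    rw [← setIntegral_eq_integral_of_forall_compl_eq_zero (s := Ioo 0 L) (fun x hx => by
      rw [image_eq_zero_of_notMem_tsupport fun h => hx (hs h), zero_smul])]
    have i1 : IntegrableOn (fun x => u (0, x) * ψ x) (Ioo 0 L) :=
      ((hc.mul hψ.continuous.continuousOn).integrableOn_compact isCompact_Icc).mono_set
        Ioo_subset_Icc_self
    have i2 : IntegrableOn (fun x => c₀ * ψ x) (Ioo 0 L) :=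
      ((continuous_const.mul hψ.continuous).continuousOn.integrableOn_compact
        isCompact_Icc).mono_set Ioo_subset_Icc_self
    calc ∫ x in Ioo 0 L, ψ x • (u (0, x) - c₀)
        = ∫ x in Ioo 0 L, (u (0, x) * ψ x - c₀ * ψ x) := by
          congr 1; ext x; rw [smul_eq_mul]; ring
      _ = 0 := by rw [integral_sub i1 i2, integral_const_mul, this, sub_self]
  have hae' : (fun x => u (0, x)) =ᵐ[volume.restrict (Icc 0 L)] fun _ => c₀ := by
    rw [← restrict_Ioo_eq_restrict_Icc, EventuallyEq, ae_restrict_iff' measurableSet_Ioo]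
    filter_upwards [hae] with x hx hx'
    exact sub_eq_zero.1 (hx hx')
  exact Measure.eqOn_Icc_of_ae_eq volume hL.ne hae' hc continuousOn_const

end Mean

/-! ### Variance, and compact sets of contact times. -/

theorem eq_zero_of_integral_sq_nonpos {L : ℝ} (hL : 0 < L) {f : ℝ → ℝ}
    (hf : ContinuousOn f (Icc 0 L)) (h : ∫ x in Ioo 0 L, f x ^ 2 ≤ 0) :
    ∀ x ∈ Icc 0 L, f x = 0 := by
  rw [← integral_Icc_eq_integral_Ioo] at h
  have hn : 0 ≤ᵐ[volume.restrict (Icc 0 L)] fun x => f x ^ 2 :=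
    Eventually.of_forall fun x => sq_nonneg _
  have h0 := (setIntegral_eq_zero_iff_of_nonneg_ae hn
    ((hf.pow 2).integrableOn_compact isCompact_Icc)).1
    (le_antisymm h (integral_nonneg fun x => sq_nonneg _))
  intro x hx
  exact pow_eq_zero_iff two_ne_zero |>.1
    (Measure.eqOn_Icc_of_ae_eq volume hL.ne h0 (hf.pow 2) continuousOn_const hx)

/-- The variance identity behind both uses of equality in Jensen's inequality. -/
theorem integral_sub_sq {L m : ℝ} (hL : 0 < L) {f : ℝ → ℝ} (hf : ContinuousOn f (Icc 0 L))
    (hm : ∫ x in Ioo 0 L, f x = L * m) :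
    ∫ x in Ioo 0 L, (f x - m) ^ 2 = (∫ x in Ioo 0 L, f x ^ 2) - L * m ^ 2 := by
  have i1 : IntegrableOn f (Ioo 0 L) :=
    (hf.integrableOn_compact isCompact_Icc).mono_set Ioo_subset_Icc_self
  have i2 : IntegrableOn (fun x => f x ^ 2) (Ioo 0 L) :=
    ((hf.pow 2).integrableOn_compact isCompact_Icc).mono_set Ioo_subset_Icc_self
  have i3 : IntegrableOn (fun _ : ℝ => m ^ 2) (Ioo 0 L) := by simp
  have : (fun x => (f x - m) ^ 2) = fun x => f x ^ 2 - 2 * m * f x + m ^ 2 := by ext x; ring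
  have i4 : IntegrableOn (fun x => 2 * m * f x) (Ioo 0 L) := i1.const_mul _
  have i5 : IntegrableOn (fun x => f x ^ 2 - 2 * m * f x) (Ioo 0 L) := i2.sub i4
  rw [this, integral_add i5 i3, integral_sub i2 i4, integral_const_mul, hm, setIntegral_const,
    Real.volume_real_Ioo_of_le hL.le, smul_eq_mul]
  ring

/-- The set is the projection of a compact set. It supplies first and last contact times, and
neighbourhoods of times that are uniform in `x`. -/
theorem isCompact_times {L a b : ℝ} (ha : 0 ≤ a) {F : ℝ × ℝ → ℝ}
    (hF : ContinuousOn F (closedStrip L)) {C : Set ℝ} (hC : IsClosed C) :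
    IsCompact {t | t ∈ Icc a b ∧ ∃ x ∈ Icc 0 L, F (t, x) ∈ C} := by
  have hK : IsCompact (Icc a b ×ˢ Icc 0 L) := isCompact_Icc.prod isCompact_Icc
  have hsub : Icc a b ×ˢ Icc 0 L ⊆ closedStrip L := Set.prod_mono
    (fun t ht => ha.trans ht.1) Subset.rfl
  have h1 : IsCompact (Icc a b ×ˢ Icc 0 L ∩ F ⁻¹' C) :=
    hK.of_isClosed_subset ((hF.mono hsub).preimage_isClosed_of_isClosed hK.isClosed hC)
      inter_subset_left
  convert! h1.image continuous_fst using 1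
  ext t
  constructor
  · rintro ⟨ht, x, hx, hF⟩
    exact ⟨(t, x), ⟨⟨ht, hx⟩, hF⟩, rfl⟩
  · rintro ⟨⟨s, x⟩, ⟨⟨hs, hx⟩, hF⟩, rfl⟩
    exact ⟨hs, x, hx, hF⟩

/-! ### The reduced problem: simultaneous contact and persistent detachment. -/

/-- The information on a displacement `u` with velocity `g` that is carried by its spatial mean `y`,
the mean velocity `p`, and the energy inequality. -/
structure IsReducedSolution (κ₂ L c₀ c₁ : ℝ) (u g : ℝ × ℝ → ℝ) (y p : ℝ → ℝ) : Prop where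
  continuousOn : ContinuousOn u (closedStrip L)
  continuousOn_velocity : ContinuousOn g (closedStrip L)
  hasDerivWithinAt : ∀ t x, 0 ≤ t → x ∈ Icc 0 L →
    HasDerivWithinAt (fun s => u (s, x)) (g (t, x)) (Ici 0) t
  initial : ∀ x ∈ Icc 0 L, u (0, x) = c₀
  hasDerivAt_mean : ∀ t, HasDerivAt y (p t) t
  continuous_meanVelocity : Continuous p
  mean_zero : y 0 = c₀
  meanVelocity_zero : p 0 = c₁
  integral_eq : ∀ t, 0 ≤ t → ∫ x in Ioo 0 L, u (t, x) = L * y t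
  integral_velocity_eq : ∀ t, 0 < t → ∫ x in Ioo 0 L, g (t, x) = L * p t
  energy_le : ∀ t, 0 ≤ t → ∫ x in Ioo 0 L, (g (t, x) ^ 2 / 2 + potential κ₂ (u (t, x)))
    ≤ L * (c₁ ^ 2 / 2 + κ₂ ^ 2 * c₀ ^ 2 / 2)
  attached : ∀ T, 0 ≤ T → (∀ t ∈ Ioo 0 T, ∀ x ∈ Icc 0 L, |u (t, x)| < 1) →
    ∀ t ∈ Icc 0 T, p t = c₁ - κ₂ ^ 2 * ∫ s in (0 : ℝ)..t, y s
  detached : ∀ S T, 0 ≤ S → (∀ t ∈ Ioo S T, ∀ x ∈ Icc 0 L, 1 < |u (t, x)|) →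
    ∀ t ∈ Icc S T, p t = p S

namespace IsReducedSolution

variable {κ₂ L c₀ c₁ : ℝ} {u g : ℝ × ℝ → ℝ} {y p : ℝ → ℝ}

theorem hasDerivAt (hs : IsReducedSolution κ₂ L c₀ c₁ u g y p) {t x : ℝ} (ht : 0 < t)
    (hx : x ∈ Icc 0 L) : HasDerivAt (fun s => u (s, x)) (g (t, x)) t :=
  (hs.hasDerivWithinAt t x ht.le hx).hasDerivAt (Ici_mem_nhds ht)

theorem continuousOn_time (hs : IsReducedSolution κ₂ L c₀ c₁ u g y p) {x : ℝ}
    (hx : x ∈ Icc 0 L) : ContinuousOn (fun s => u (s, x)) (Ici 0) :=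
  fun t ht => (hs.hasDerivWithinAt t x ht hx).continuousWithinAt

theorem sub_eq_sub (hs : IsReducedSolution κ₂ L c₀ c₁ u g y p) {a b x : ℝ} {q q' : ℝ → ℝ}
    (ha : 0 ≤ a) (hab : a ≤ b) (hx : x ∈ Icc 0 L) (hq : ∀ t, HasDerivAt q (q' t) t)
    (h : ∀ t ∈ Ioo a b, g (t, x) = q' t) : u (b, x) - u (a, x) = q b - q a := by
  rcases hab.eq_or_lt with rfl | hlt
  · simp
  have hc : ContinuousOn (fun s => u (s, x) - q s) (Icc a b) :=
    ((hs.continuousOn_time hx).mono fun t ht => ha.trans ht.1).sub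
      fun t _ => (hq t).continuousAt.continuousWithinAt
  obtain ⟨c, hc, he⟩ := exists_hasDerivAt_eq_slope _ _ hlt hc
    fun t ht => (hs.hasDerivAt (ha.trans_lt ht.1) hx).sub (hq t)
  rw [h c hc, sub_self, eq_comm, div_eq_zero_iff, or_iff_left (sub_pos.2 hlt).ne'] at he
  linarith

theorem integral_velocity_sq_le_of_one_le_abs (hL : 0 < L)
    (hs : IsReducedSolution κ₂ L c₀ c₁ u g y p) {t : ℝ}
    (ht : 0 ≤ t) (hu : ∀ x ∈ Icc 0 L, 1 ≤ |u (t, x)|) :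
    ∫ x in Ioo 0 L, g (t, x) ^ 2 ≤ L * (c₁ ^ 2 + κ₂ ^ 2 * c₀ ^ 2 - κ₂ ^ 2) := by
  have h1 := hs.energy_le t ht
  have i1 : IntegrableOn (fun x => g (t, x) ^ 2) (Ioo 0 L) :=
    integrableOn_section (F := fun z => g z ^ 2) (hs.continuousOn_velocity.pow 2) ht
  have e : ∫ x in Ioo 0 L, (g (t, x) ^ 2 / 2 + potential κ₂ (u (t, x)))
      = ∫ x in Ioo 0 L, (g (t, x) ^ 2 / 2 + κ₂ ^ 2 / 2) :=
    setIntegral_congr_fun measurableSet_Ioo fun x hx => by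
      simp only [potential_eq_of_le_abs (hu x (Ioo_subset_Icc_self hx))]
  rw [e, integral_add (i1.div_const 2) (by simp), integral_div, setIntegral_const] at h1
  simp only [Real.volume_real_Ioo_of_le hL.le, sub_zero, smul_eq_mul] at h1
  linarith

/-- By `he` the means already use up the whole energy, so the bound leaves no room for a variance of
the velocity. -/
theorem velocity_eq_of_attached (hL : 0 < L)
    (hs : IsReducedSolution κ₂ L c₀ c₁ u g y p) {t : ℝ}
    (ht : 0 < t) (hu : ∀ x ∈ Icc 0 L, |u (t, x)| ≤ 1)
    (he : p t ^ 2 + κ₂ ^ 2 * y t ^ 2 = c₁ ^ 2 + κ₂ ^ 2 * c₀ ^ 2) :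
    ∀ x ∈ Icc 0 L, g (t, x) = p t := by
  have h1 := hs.energy_le t ht.le
  have cu := continuousOn_section hs.continuousOn ht.le
  have cg := continuousOn_section hs.continuousOn_velocity ht.le
  have i1 : IntegrableOn (fun x => g (t, x) ^ 2) (Ioo 0 L) :=
    integrableOn_section (F := fun z => g z ^ 2) (hs.continuousOn_velocity.pow 2) ht.le
  have i2 : IntegrableOn (fun x => u (t, x) ^ 2) (Ioo 0 L) :=
    integrableOn_section (F := fun z => u z ^ 2) (hs.continuousOn.pow 2) ht.le
  have e : ∫ x in Ioo 0 L, (g (t, x) ^ 2 / 2 + potential κ₂ (u (t, x)))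
      = ∫ x in Ioo 0 L, (g (t, x) ^ 2 / 2 + κ₂ ^ 2 / 2 * u (t, x) ^ 2) :=
    setIntegral_congr_fun measurableSet_Ioo fun x hx => by
      simp only [potential_eq_of_abs_le (hu x (Ioo_subset_Icc_self hx))]
      ring
  rw [e, integral_add (i1.div_const 2) (i2.const_mul _), integral_div, integral_const_mul] at h1
  have v1 := integral_sub_sq hL cu (hs.integral_eq t ht.le)
  have v2 := integral_sub_sq hL cg (hs.integral_velocity_eq t ht)
  have v3 : 0 ≤ ∫ x in Ioo 0 L, (u (t, x) - y t) ^ 2 := integral_nonneg fun x => sq_nonneg _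
  have v4 : κ₂ ^ 2 * (L * y t ^ 2) ≤ κ₂ ^ 2 * ∫ x in Ioo 0 L, u (t, x) ^ 2 := by
    gcongr; linarith
  have v5 : L * (p t ^ 2 + κ₂ ^ 2 * y t ^ 2) = L * (c₁ ^ 2 + κ₂ ^ 2 * c₀ ^ 2) := by rw [he]
  have := eq_zero_of_integral_sq_nonpos hL (f := fun x => g (t, x) - p t)
    (cg.sub continuousOn_const) (by rw [v2]; linarith)
  exact fun x hx => sub_eq_zero.1 (this x hx)

/-- Here the potential is saturated at `κ₂² / 2`, and `he` says that the mean velocity uses up all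
the remaining energy. -/
theorem velocity_eq_of_detached (hL : 0 < L)
    (hs : IsReducedSolution κ₂ L c₀ c₁ u g y p) {t : ℝ}
    (ht : 0 < t) (hu : ∀ x ∈ Icc 0 L, 1 ≤ |u (t, x)|)
    (he : p t ^ 2 = c₁ ^ 2 + κ₂ ^ 2 * c₀ ^ 2 - κ₂ ^ 2) :
    ∀ x ∈ Icc 0 L, g (t, x) = p t := by
  have h1 := hs.integral_velocity_sq_le_of_one_le_abs hL ht.le hu
  have cg := continuousOn_section hs.continuousOn_velocity ht.le
  have v2 := integral_sub_sq hL cg (hs.integral_velocity_eq t ht)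
  rw [← he] at h1
  have := eq_zero_of_integral_sq_nonpos hL (f := fun x => g (t, x) - p t)
    (cg.sub continuousOn_const) (by rw [v2]; linarith)
  exact fun x hx => sub_eq_zero.1 (this x hx)

/-- Complete detachment requires more energy than the detachment threshold. -/
theorem lt_energy_of_detached (hL : 0 < L) (hc₀ : |c₀| < 1)
    (hs : IsReducedSolution κ₂ L c₀ c₁ u g y p) {T : ℝ} (hT : 0 ≤ T)
    (hdet : ∀ x ∈ Icc 0 L, 1 < |u (T, x)|) : κ₂ ^ 2 < c₁ ^ 2 + κ₂ ^ 2 * c₀ ^ 2 := by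
  by_contra! hle
  have h0L : (0 : ℝ) ∈ Icc 0 L := left_mem_Icc.2 hL.le
  have hK := isCompact_times (b := T) le_rfl (F := fun z => |u z|) hs.continuousOn.abs
    (isClosed_Iic (a := (1 : ℝ)))
  -- `τ` is the last time up to `T` at which some point `x` has `|u| ≤ 1`; time `0` is such a time.
  -- Afterwards the energy bound forces zero velocity, so `u` at this `x` cannot change before `T`.
  obtain ⟨τ, ⟨⟨hτ0, hτT⟩, x, hx, hux⟩, hmax⟩ := hK.exists_isGreatest
    ⟨0, ⟨le_rfl, hT⟩, 0, h0L, by simpa [hs.initial 0 h0L] using hc₀.le⟩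
  have hg : ∀ t ∈ Ioo τ T, g (t, x) = 0 := by
    intro t ht
    have hu : ∀ x ∈ Icc 0 L, 1 ≤ |u (t, x)| := by
      intro x hx
      by_contra! hlt
      exact absurd (hmax ⟨⟨hτ0.trans ht.1.le, ht.2.le⟩, x, hx, hlt.le⟩) (not_le.2 ht.1)
    refine eq_zero_of_integral_sq_nonpos hL
      (continuousOn_section hs.continuousOn_velocity (hτ0.trans ht.1.le))
      ((hs.integral_velocity_sq_le_of_one_le_abs hL (hτ0.trans ht.1.le) hu).trans ?_) x hx
    exact mul_nonpos_of_nonneg_of_nonpos hL.le (by linarith)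
  have := hs.sub_eq_sub (q := fun _ => 0) (q' := fun _ => 0) hτ0 hτT hx
    (fun t => hasDerivAt_const t 0) hg
  have hu := hdet x hx
  rw [show u (T, x) = u (τ, x) by linarith] at hu
  exact absurd hu (not_lt.2 hux)

/-- Up to the first time at which some point reaches `|u| = 1`, the mean is a harmonic oscillator
and `u` equals its mean, so that time is common to all points. Here `σ` is the value `y τ`. -/
theorem exists_detachment_time (hL : 0 < L) (hc₀ : |c₀| < 1)
    (hs : IsReducedSolution κ₂ L c₀ c₁ u g y p) {T : ℝ} (hT : 0 ≤ T)
    (hdet : ∀ x ∈ Icc 0 L, 1 < |u (T, x)|) :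
    ∃ τ σ : ℝ, 0 < τ ∧ τ ≤ T ∧ σ ^ 2 = 1 ∧ 0 < σ * p τ ∧
      p τ ^ 2 = c₁ ^ 2 + κ₂ ^ 2 * c₀ ^ 2 - κ₂ ^ 2 ∧
      ∀ x ∈ Icc 0 L, u (τ, x) = σ ∧ g (τ, x) = p τ := by
  have h0L : (0 : ℝ) ∈ Icc 0 L := left_mem_Icc.2 hL.le
  have henergy := hs.lt_energy_of_detached hL hc₀ hT hdet
  have hK := isCompact_times (b := T) le_rfl (F := fun z => |u z|) hs.continuousOn.abs
    (isClosed_Ici (a := (1 : ℝ)))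
  obtain ⟨τ, ⟨⟨hτ0, hτT⟩, x₀, hx₀, hux₀⟩, hmin⟩ := hK.exists_isLeast
    ⟨T, ⟨hT, le_rfl⟩, 0, h0L, (hdet 0 h0L).le⟩
  have hτ : 0 < τ := by
    refine hτ0.lt_of_ne fun h => ?_
    rw [← h, mem_Ici, hs.initial x₀ hx₀] at hux₀
    exact absurd hc₀ (not_lt.2 hux₀)
  have hu : ∀ t ∈ Ico 0 τ, ∀ x ∈ Icc 0 L, |u (t, x)| < 1 := by
    intro t ht x hx
    by_contra! hge
    exact absurd (hmin ⟨⟨ht.1, ht.2.le.trans hτT⟩, x, hx, hge⟩) (not_le.2 ht.2)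
  have hyc : Continuous y := continuous_iff_continuousAt.2 fun t =>
    (hs.hasDerivAt_mean t).continuousAt
  have hp := hs.attached τ hτ0 fun t ht => hu t ⟨ht.1.le, ht.2⟩
  have hp' : ∀ t ∈ Ioo 0 τ, HasDerivAt p (-(κ₂ ^ 2 * y t)) t := by
    intro t ht
    have h1 : HasDerivAt (fun t => ∫ s in (0 : ℝ)..t, y s) (y t) t :=
      intervalIntegral.integral_hasDerivAt_right (hyc.intervalIntegrable _ _)
        (hyc.stronglyMeasurableAtFilter _ _) hyc.continuousAt
    refine ((h1.const_mul (κ₂ ^ 2)).const_sub c₁).congr_of_eventuallyEq ?_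
    filter_upwards [Ioo_mem_nhds ht.1 ht.2] with s hs'
    exact hp s (Ioo_subset_Icc_self hs')
  have he : ∀ t ∈ Icc 0 τ, p t ^ 2 + κ₂ ^ 2 * y t ^ 2 = c₁ ^ 2 + κ₂ ^ 2 * c₀ ^ 2 := by
    intro t ht
    rw [← hs.mean_zero, ← hs.meanVelocity_zero]
    rcases ht.1.eq_or_lt with rfl | hlt
    · rfl
    have hd : ∀ r ∈ Ioo 0 t, HasDerivAt (fun t => p t ^ 2 + κ₂ ^ 2 * y t ^ 2) 0 r := by
      intro r hr
      convert! ((hp' r ⟨hr.1, hr.2.trans_le ht.2⟩).fun_pow 2).add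
        (((hs.hasDerivAt_mean r).fun_pow 2).const_mul (κ₂ ^ 2)) using 1
      norm_num
      ring
    have hcp := hs.continuous_meanVelocity
    obtain ⟨c, -, hc⟩ := exists_hasDerivAt_eq_slope _ _ hlt
      (show Continuous (fun t => p t ^ 2 + κ₂ ^ 2 * y t ^ 2) by fun_prop).continuousOn hd
    rw [eq_comm, div_eq_zero_iff, or_iff_left (sub_pos.2 hlt).ne'] at hc
    linarith
  have huy : ∀ t ∈ Icc 0 τ, ∀ x ∈ Icc 0 L, u (t, x) = y t := by
    intro t ht x hx
    have := hs.sub_eq_sub (q := y) (q' := p) le_rfl ht.1 hx hs.hasDerivAt_mean fun r hr =>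
      hs.velocity_eq_of_attached hL hr.1
        (fun x hx => (hu r ⟨hr.1.le, hr.2.trans_le ht.2⟩ x hx).le)
        (he r ⟨hr.1.le, hr.2.le.trans ht.2⟩) x hx
    rw [hs.initial x hx, hs.mean_zero] at this
    linarith
  have hy1 : ∀ t ∈ Icc 0 τ, |y t| ≤ 1 := by
    have hsub : Ico 0 τ ⊆ {t | |y t| ≤ 1} := fun t ht => by
      change |y t| ≤ 1
      rw [← huy t (Ico_subset_Icc_self ht) 0 h0L]
      exact (hu t ht 0 h0L).le
    have hcl := closure_minimal hsub (isClosed_le hyc.abs continuous_const)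
    rw [closure_Ico hτ.ne] at hcl
    exact fun t ht => hcl ht
  have hτm : τ ∈ Icc 0 τ := ⟨hτ0, le_rfl⟩
  have hyτ : y τ ^ 2 = 1 := by
    rw [mem_Ici, huy τ hτm x₀ hx₀] at hux₀
    rw [← sq_abs, le_antisymm (hy1 τ hτm) hux₀, one_pow]
  have hpτ : p τ ^ 2 = c₁ ^ 2 + κ₂ ^ 2 * c₀ ^ 2 - κ₂ ^ 2 := by
    rw [← he τ hτm, hyτ]; ring
  refine ⟨τ, y τ, hτ, hτT, hyτ, ?_, hpτ, fun x hx => ⟨huy τ hτm x hx, ?_⟩⟩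
  · have hd : HasDerivAt (fun t => y t ^ 2) (2 * (y τ * p τ)) τ := by
      convert! (hs.hasDerivAt_mean τ).fun_pow 2 using 1
      norm_num
      ring
    -- `y²` stays at most `1` before `τ` and equals `1` at `τ`, so its left difference quotients are
    -- nonnegative. Strict positivity then follows from the energy threshold.
    have hnn : 0 ≤ 2 * (y τ * p τ) := by
      refine ge_of_tendsto (hasDerivWithinAt_iff_tendsto_slope' (s := Iio τ) (by simp) |>.1
        hd.hasDerivWithinAt) ?_
      filter_upwards [Ico_mem_nhdsLT hτ] with t ht
      rw [slope_def_field, hyτ]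
      refine div_nonneg_of_nonpos ?_ (sub_nonpos.2 ht.2.le)
      have := (sq_le_one_iff_abs_le_one _).2 (hy1 t (Ico_subset_Icc_self ht))
      linarith
    refine lt_of_le_of_ne (by linarith) fun h0 => ?_
    have : (y τ * p τ) ^ 2 = 0 := by rw [← h0]; ring
    rw [mul_pow, hyτ, hpτ] at this
    linarith
  · refine hs.velocity_eq_of_attached hL hτ (fun x hx => ?_) (he τ hτm) x hx
    rw [huy τ hτm x hx]
    exact hy1 τ hτm

theorem eq_of_detached (hL : 0 < L) (hs : IsReducedSolution κ₂ L c₀ c₁ u g y p) {τ σ T : ℝ}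
    (hτ : 0 < τ) (hσ : σ ^ 2 = 1) (hp : p τ ^ 2 = c₁ ^ 2 + κ₂ ^ 2 * c₀ ^ 2 - κ₂ ^ 2)
    (hu : ∀ x ∈ Icc 0 L, u (τ, x) = σ) (hT : τ ≤ T)
    (hdet : ∀ t ∈ Ioo τ T, ∀ x ∈ Icc 0 L, 1 < σ * u (t, x)) :
    ∀ x ∈ Icc 0 L, u (T, x) = σ + p τ * (T - τ) := by
  intro x hx
  have hdet' : ∀ t ∈ Ioo τ T, ∀ x ∈ Icc 0 L, 1 < |u (t, x)| := by
    intro t ht x hx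
    have h1 : |σ| = 1 := (pow_eq_one_iff_of_nonneg (abs_nonneg σ) two_ne_zero).1
      (by rw [sq_abs, hσ])
    calc 1 < σ * u (t, x) := hdet t ht x hx
      _ ≤ |σ * u (t, x)| := le_abs_self _
      _ = |u (t, x)| := by rw [abs_mul, h1, one_mul]
  have hpc := hs.detached τ T hτ.le hdet'
  have := hs.sub_eq_sub (q := fun t => p τ * t) (q' := fun _ => p τ) hτ.le hT hx
    (fun t => by simpa using (hasDerivAt_id t).const_mul (p τ)) fun t ht => by
      have ht' := hpc t (Ioo_subset_Icc_self ht)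
      rw [← ht']
      exact hs.velocity_eq_of_detached hL (hτ.trans ht.1) (fun x hx => (hdet' t ht x hx).le)
        (by rw [ht', hp]) x hx
  rw [hu x hx] at this
  linarith

/-- Outward velocity gives detachment just after `τ`. At a first return to the threshold, the
explicit linear motion would put `σ u` strictly above `1`, a contradiction. -/
theorem one_lt_of_detachment_time (hL : 0 < L) (hs : IsReducedSolution κ₂ L c₀ c₁ u g y p)
    {τ σ : ℝ} (hτ : 0 < τ) (hσ : σ ^ 2 = 1) (hpos : 0 < σ * p τ)
    (hp : p τ ^ 2 = c₁ ^ 2 + κ₂ ^ 2 * c₀ ^ 2 - κ₂ ^ 2)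
    (hu : ∀ x ∈ Icc 0 L, u (τ, x) = σ ∧ g (τ, x) = p τ) {t : ℝ} (ht : τ < t) :
    ∀ x ∈ Icc 0 L, 1 < σ * u (t, x) := by
  have hK := isCompact_times (b := τ + 1) hτ.le (F := fun z => σ * g z)
    (continuousOn_const.mul hs.continuousOn_velocity) (isClosed_Iic (a := (0 : ℝ)))
  have hnm : τ ∉ {t | t ∈ Icc τ (τ + 1) ∧ ∃ x ∈ Icc 0 L, σ * g (t, x) ∈ Iic 0} := by
    rintro ⟨-, x, hx, hle⟩
    rw [(hu x hx).2, mem_Iic] at hle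
    linarith
  -- The times at which `σ g ≤ 0` somewhere form a closed set missing `τ`, so one `δ` serves all
  -- `x`.
  obtain ⟨δ, hδ, hball⟩ := Metric.mem_nhds_iff.1 (hK.isClosed.isOpen_compl.mem_nhds hnm)
  have hδ' : 0 < min δ 1 := lt_min hδ one_pos
  have hgpos : ∀ r ∈ Ioo τ (τ + min δ 1), ∀ x ∈ Icc 0 L, 0 < σ * g (r, x) := by
    intro r hr x hx
    by_contra! hle
    refine hball (a := r) ?_ ⟨⟨hr.1.le, ?_⟩, x, hx, hle⟩
    · rw [Metric.mem_ball, Real.dist_eq, abs_of_pos (sub_pos.2 hr.1)]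
      linarith [hr.2, min_le_left δ 1]
    · linarith [hr.2, min_le_right δ 1]
  have hstart : ∀ r ∈ Ioc τ (τ + min δ 1), ∀ x ∈ Icc 0 L, 1 < σ * u (r, x) := by
    intro r hr x hx
    obtain ⟨c, hc, he⟩ := exists_hasDerivAt_eq_slope (fun s => σ * u (s, x)) _ hr.1
      (continuousOn_const.mul ((hs.continuousOn_time hx).mono fun s hs => hτ.le.trans hs.1))
      fun s hs' => (hs.hasDerivAt (hτ.trans hs'.1) hx).const_mul σ
    have h1 := hgpos c ⟨hc.1, hc.2.trans_le hr.2⟩ x hx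
    rw [he] at h1
    have h2 := (div_pos_iff_of_pos_right (sub_pos.2 hr.1)).1 h1
    rw [(hu x hx).1] at h2
    linarith [hσ, sq σ]
  intro x hx
  by_contra! hle
  have hδt : τ + min δ 1 ≤ t := by
    by_contra! hlt
    exact absurd (hstart t ⟨ht, hlt.le⟩ x hx) (not_lt.2 hle)
  -- The search for a return begins at `τ + min δ 1`, since `σ u = 1` at `τ` itself would make `τ` a
  -- trivial first time.
  have hK₂ := isCompact_times (a := τ + min δ 1) (b := t) (by linarith) (F := fun z => σ * u z)
    (continuousOn_const.mul hs.continuousOn) (isClosed_Iic (a := (1 : ℝ)))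
  obtain ⟨T, ⟨⟨hT1, hT2⟩, z, hz, hTz⟩, hmin⟩ := hK₂.exists_isLeast
    ⟨t, ⟨hδt, le_rfl⟩, x, hx, hle⟩
  have hT := hs.eq_of_detached hL hτ hσ hp (fun x hx => (hu x hx).1) (T := T) (by linarith)
    (by
      intro r hr w hw
      rcases le_or_gt r (τ + min δ 1) with h | h
      · exact hstart r ⟨hr.1, h⟩ w hw
      · by_contra! hle'
        exact absurd (hmin ⟨⟨h.le, hr.2.le.trans hT2⟩, w, hw, hle'⟩) (not_le.2 hr.2)) z hz
  rw [mem_Iic, hT, mul_add, ← sq, hσ, ← mul_assoc] at hTz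
  have := mul_pos hpos (show 0 < T - τ by linarith)
  linarith

/-- After complete detachment the displacement is constant in space. -/
theorem eq_const_of_detached (hL : 0 < L) (hc₀ : |c₀| < 1)
    (hs : IsReducedSolution κ₂ L c₀ c₁ u g y p) {T : ℝ} (hT : 0 ≤ T)
    (hdet : ∀ x ∈ Icc 0 L, 1 < |u (T, x)|) {t : ℝ} (ht : T ≤ t) :
    ∃ c : ℝ, ∀ x ∈ Icc 0 L, u (t, x) = c := by
  obtain ⟨τ, σ, hτ, hτT, hσ, hpos, hp, hu⟩ := hs.exists_detachment_time hL hc₀ hT hdet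
  exact ⟨_, hs.eq_of_detached hL hτ hσ hp (fun x hx => (hu x hx).1) (hτT.trans ht)
    fun r hr => hs.one_lt_of_detachment_time hL hτ hσ hpos hp hu hr.1⟩

end IsReducedSolution

/-! ### From dissipative solutions to the reduced problem. -/

theorem hasDerivAt_integral_section {L : ℝ} {u : ℝ × ℝ → ℝ} (hL : 0 < L)
    (hC1 : ContDiffOn ℝ 1 u (closedStrip L)) {t : ℝ} (ht : 0 < t) :
    HasDerivAt (fun s => ∫ x in Ioo 0 L, u (s, x)) (∫ x in Ioo 0 L, timeDeriv L u (t, x)) t := by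
  have hg := continuousOn_timeDeriv hL hC1
  have hsub : Icc 0 (t + 1) ×ˢ Icc 0 L ⊆ closedStrip L :=
    Set.prod_mono Icc_subset_Ici_self Subset.rfl
  obtain ⟨K, hK⟩ := (isCompact_Icc.prod isCompact_Icc).exists_bound_of_continuousOn (hg.mono hsub)
  have hmem : ∀ᵐ x ∂(volume.restrict (Ioo 0 L)), x ∈ Ioo 0 L := ae_restrict_mem measurableSet_Ioo
  refine (hasDerivAt_integral_of_dominated_loc_of_deriv_le (bound := fun _ => K)
    (F' := fun s x => timeDeriv L u (s, x)) (Ioo_mem_nhds ht (lt_add_one t)) ?_ ?_ ?_ ?_ ?_ ?_).2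
  · filter_upwards [lt_mem_nhds ht] with s hs
    exact (integrableOn_section hC1.continuousOn hs.le).aestronglyMeasurable
  · exact integrableOn_section hC1.continuousOn ht.le
  · exact (integrableOn_section hg ht.le).aestronglyMeasurable
  · filter_upwards [hmem] with x hx s hs
    exact hK _ ⟨Ioo_subset_Icc_self hs, Ioo_subset_Icc_self hx⟩
  · exact integrable_const _
  · filter_upwards [hmem] with x hx s hs
    exact (hasDerivWithinAt_timeDeriv hC1 hs.1.le (Ioo_subset_Icc_self hx)).hasDerivAt
      (Ici_mem_nhds hs.1)

/-- `p` and `y` are successive primitives of the averaged force, hence defined for all real times.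
The force is only integrable, so the attached and detached laws are obtained in integrated form,
from the value of the subdifferential at almost every point. -/
theorem IsDissipativeSolution.exists_isReducedSolution {κ₁ κ₂ L : ℝ} (hL : 0 < L)
    {v₀ v₁ : ℝ → ℝ} {u : ℝ × ℝ → ℝ} (hu : IsDissipativeSolution κ₁ κ₂ L v₀ v₁ u)
    {c₀ c₁ : ℝ} (hc₀ : |c₀| < 1)
    (hv₀ : ∀ᵐ x ∂(volume.restrict (Ioo 0 L)), v₀ x = c₀)
    (hv₁ : ∀ᵐ x ∂(volume.restrict (Ioo 0 L)), v₁ x = c₁)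
    (hC1 : ContDiffOn ℝ 1 u (closedStrip L)) :
    ∃ y p, IsReducedSolution κ₂ L c₀ c₁ u (timeDeriv L u) y p := by
  obtain ⟨h, hm, hsub, hweak⟩ := hu.weak
  have hw := hu.dxx_mem.integrableOn
  have hh := integrableOn_of_mem_subdifferential hm hsub
  obtain ⟨b, hb, hbh, hmean⟩ :=
    integral_eq_of_isWeakSolution hL hu.continuousOn hw hh hv₀ hv₁ hweak
  have hsec : ∀ᵐ t : ℝ, t ∈ Ioi (0 : ℝ) → ∀ᵐ x ∂(volume.restrict (Ioo 0 L)),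
      h (t, x) ∈ subdifferential (potential κ₂) (u (t, x)) := by
    rw [strip, restrict_prod_eq] at hsub
    exact (ae_restrict_iff' measurableSet_Ioi).1 (Measure.ae_ae_of_ae_prod hsub)
  have hmem : ∀ᵐ x ∂(volume.restrict (Ioo 0 L)), x ∈ Icc 0 L := by
    filter_upwards [ae_restrict_mem measurableSet_Ioo] with x hx using Ioo_subset_Icc_self hx
  have hBc : Continuous fun t => ∫ s in (0 : ℝ)..t, b s := intervalIntegral.continuous_primitive hb 0
  set p : ℝ → ℝ := fun t => c₁ - (∫ s in (0 : ℝ)..t, b s) / L with hp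
  have hpc : Continuous p := by fun_prop
  set y : ℝ → ℝ := fun t => c₀ + ∫ s in (0 : ℝ)..t, p s with hy
  have hyd : ∀ t, HasDerivAt y (p t) t := fun t =>
    (intervalIntegral.integral_hasDerivAt_right (hpc.intervalIntegrable _ _)
      (hpc.stronglyMeasurableAtFilter _ _) hpc.continuousAt).const_add c₀
  have hmu : ∀ t, 0 ≤ t → ∫ x in Ioo 0 L, u (t, x) = L * y t := by
    intro t ht
    rw [hmean t ht, hy]
    simp only [hp]
    rw [intervalIntegral.integral_sub (by simp) ((hBc.div_const L).intervalIntegrable _ _),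
      intervalIntegral.integral_div, intervalIntegral.integral_const, smul_eq_mul, sub_zero]
    field_simp
    ring
  refine ⟨y, p, hu.continuousOn, continuousOn_timeDeriv hL hC1,
    fun t x ht hx => hasDerivWithinAt_timeDeriv hC1 ht hx,
    eq_const_at_zero_of_isWeakSolution hL hu.continuousOn hw hh hv₀ hv₁ hweak, hyd, hpc,
    by simp [hy], by simp [hp], hmu, ?_, ?_, ?_, ?_⟩
  · intro t ht
    refine (hasDerivAt_integral_section hL hC1 ht).unique
      (((hyd t).const_mul L).congr_of_eventuallyEq ?_)
    filter_upwards [lt_mem_nhds ht] with s hs using hmu s hs.le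
  · intro t ht
    rw [← initialEnergy_of_const (κ₁ := κ₁) hL hc₀.le hu.memH2_data hv₀ hv₁]
    exact integral_timeDeriv_sq_add_potential_le hL hu hC1 ht
  · intro T hT hatt t ht
    have : ∫ s in (0 : ℝ)..t, b s = ∫ s in (0 : ℝ)..t, L * κ₂ ^ 2 * y s := by
      rw [intervalIntegral.integral_of_le ht.1, intervalIntegral.integral_of_le ht.1,
        integral_Ioc_eq_integral_Ioo, integral_Ioc_eq_integral_Ioo]
      refine setIntegral_congr_ae measurableSet_Ioo ?_
      filter_upwards [hsec] with s hs hs'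
      rw [hbh s hs'.1, mul_comm L, mul_assoc, ← hmu s hs'.1.le, ← integral_const_mul]
      refine integral_congr_ae ?_
      filter_upwards [hs hs'.1, hmem] with x hx hxm
      exact eq_of_mem_subdifferential_of_abs_lt
        (hatt s ⟨hs'.1, hs'.2.trans_le ht.2⟩ x hxm) hx
    simp only [hp, this, intervalIntegral.integral_const_mul]
    field_simp
  · intro S T hS hdet t ht
    have : ∫ s in S..t, b s = 0 := by
      rw [intervalIntegral.integral_of_le ht.1, integral_Ioc_eq_integral_Ioo]
      refine (setIntegral_congr_ae (g := fun _ => 0) measurableSet_Ioo ?_).trans (by simp)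
      filter_upwards [hsec] with s hs hs'
      have hs0 : 0 < s := hS.trans_lt hs'.1
      rw [hbh s hs0]
      refine (integral_congr_ae (g := fun _ => 0) ?_).trans (by simp)
      filter_upwards [hs hs0, hmem] with x hx hxm
      exact eq_zero_of_mem_subdifferential_of_lt_abs
        (hdet s ⟨hs'.1, hs'.2.trans_le ht.2⟩ x hxm) hx
    simp only [hp]
    rw [← intervalIntegral.integral_add_adjacent_intervals (hb 0 S) (hb S t), this, add_zero]

end Beam

theorem mainTheorem1 (κ₁ κ₂ L : ℝ) (hκ₁ : 0 < κ₁) (hL : 0 < L)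
    (v₀ v₁ : ℝ → ℝ) (u : ℝ × ℝ → ℝ)
    (hu : Beam.IsDissipativeSolution κ₁ κ₂ L v₀ v₁ u)
    (c₀ c₁ : ℝ) (hc₀ : |c₀| < 1)
    (hv₀ : ∀ᵐ x ∂(volume.restrict (Ioo 0 L)), v₀ x = c₀)
    (hv₁ : ∀ᵐ x ∂(volume.restrict (Ioo 0 L)), v₁ x = c₁)
    (tbar : ℝ) (htbar : 0 < tbar) (hdetached : ∀ x ∈ Icc 0 L, 1 < |u (tbar, x)|)
    (hC1 : ContDiffOn ℝ 1 u (Beam.closedStrip L))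
    (henergy : ∀ᵐ t ∂(volume.restrict (Ioi (0 : ℝ))),
      Beam.energy κ₁ κ₂ L u t = Beam.initialEnergy κ₁ κ₂ L v₀ v₁) :
    ∀ t, tbar ≤ t → ∃ c : ℝ, ∀ x ∈ Icc 0 L, u (t, x) = c := by
  obtain ⟨y, p, hs⟩ := hu.exists_isReducedSolution hL hc₀ hv₀ hv₁ hC1
  exact fun t ht => hs.eq_const_of_detached hL hc₀ htbar.le hdetached ht
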